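/- Let $k$ be an algebraically closed field of characteristic $3$, and let $\mathbb{F}_3\subset k$ be its prime field. Definitions. A *space $L_{12,2}$* is a set $\Omega$ of meromorphic differential forms $\omega=f(X)\,dX$, $f\in k(X)$, on $\mathbb{P}^1_k$ that is a $2$-dimensional $\mathbb{F}_3$-vector space such that every nonzero $\omega\in\Omega$ is logarithmic (that is, $\omega=dF/F$ for some $F\in k(X)^\times$) and has a unique zero, which is at $\infty$ and has order $10$. Let $Q_1,Q_2\in k[X]$ be polynomials of degree $4$ such that $\deg(iQ_1+jQ_2)=4$ for all $(i,j)\in\mathbb{F}_3^2\setminus\{(0,0)\}$, and put $$\omega_1=\frac{dX}{Q_1Q_2^{2}-Q_1^3},\qquad \omega_2=\frac{dX}{Q_2Q_1^{2}-Q_2^3}.$$ The pair $(Q_1,Q_2)$ is a *prompt* for a space $\Omega$ of type $L_{12,2}$ if for some $c\in k^\times$ the forms $\omega_1/c^3,\ \omega_2/c^3$ (which are the forms attached in the same way to $(cQ_1,cQ_2)$) are a basis of $\Omega$ over $\mathbb{F}_3$. Two spaces $\Omega,\Omega'$ of type $L_{12,2}$ are *equivalent* if $\Omega'=\sigma^\star\Omega$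 for some $\sigma\in\mathrm{Aut}_k(\mathbb{P}^1_k)$ with $\sigma(\infty)=\infty$. Theorem. (1) Let $a\in k$ with $a^2\notin\mathbb{F}_3$. Then the pair $(Q_{1,a},Q_{2,a})$ with $$Q_{1,a}=X^4-(a^4+a^2-1)X^2+1,\qquad Q_{2,a}=a\bigl(X^4+(a^4-a^2-1)X^2+a^8\bigr)$$ is a prompt for exactly one space $L_{12,2}$, denoted by $\Omega_a$. (2) Conversely, for every space $\Omega$ of type $L_{12,2}$ there exists $a\in k$ with $a^2\notin\mathbb{F}_3$ such that $\Omega$ is equivalent to $\Omega_a$. -/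

import Mathlib

open Polynomial
open scoped KaehlerDifferential

noncomputable section

namespace LogForms

variable (k : Type*) [Field k]

/-- The `k(X)`-vector space of meromorphic differential forms on the projective line over `k`. -/
abbrev Form : Type _ := Ω[RatFunc k⁄k]

/-- The form `dX`. -/
def dX : Form k := KaehlerDifferential.D k (RatFunc k) RatFunc.X

theorem smul_dX_bijective :
    Function.Bijective (LinearMap.toSpanSingleton (RatFunc k) (Form k) (dX k)) := by
  have : Algebra.FormallyEtale k[X] (RatFunc k) :=
    Algebra.FormallyEtale.of_isLocalization (nonZeroDivisors k[X])
  let e : RatFunc k ≃ₗ[RatFunc k] Form k :=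
    (TensorProduct.AlgebraTensorModule.rid k[X] (RatFunc k) (RatFunc k)).symm ≪≫ₗ
      TensorProduct.AlgebraTensorModule.congr (LinearEquiv.refl (RatFunc k) (RatFunc k))
        (KaehlerDifferential.polynomialEquiv k).symm ≪≫ₗ
      KaehlerDifferential.tensorKaehlerEquivOfFormallyEtale k k[X] (RatFunc k)
  have he : LinearMap.toSpanSingleton (RatFunc k) (Form k) (dX k) = e.toLinearMap := by
    apply LinearMap.ext_ring
    simp [e, dX, KaehlerDifferential.tensorKaehlerEquivOfFormallyEtale_apply]
  rw [he]
  exact e.bijective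

/-- The coefficient of a form: `coeff (f dX) = f`. -/
def coeff : Form k ≃ₗ[RatFunc k] RatFunc k :=
  (LinearEquiv.ofBijective _ (smul_dX_bijective k)).symm

variable {k}

theorem coeff_smul_dX (f : RatFunc k) : coeff k (f • dX k) = f :=
  (LinearEquiv.symm_apply_eq _).2 rfl

/-- The order of the form `f dX` at the finite point `x`, that is, the order of `f` at `x`
(meaningful for nonzero forms). -/
def ordAt (x : k) (ω : Form k) : ℤ :=
  ((coeff k ω).num.rootMultiplicity x : ℤ) - ((coeff k ω).denom.rootMultiplicity x : ℤ)

/-- The order of the form `f dX` at `∞`, that is, `ord₀ (f (1 / X)) - 2`, where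
`ord₀ (f (1 / X)) = - deg f` (meaningful for nonzero forms). -/
def ordInfty (ω : Form k) : ℤ :=
  -(coeff k ω).intDegree - 2

/-- A form is logarithmic if it is `dF / F` for some nonzero rational function `F`. -/
def IsLogarithmic (ω : Form k) : Prop :=
  ∃ F : RatFunc k, F ≠ 0 ∧ ω = F⁻¹ • KaehlerDifferential.D k (RatFunc k) F

variable (p : ℕ) [Fact p.Prime] [Algebra (ZMod p) k]

/-- `Ω` is a space `L_{M,n}` (with `M = m + 1`): an `n`-dimensional `𝔽_p`-vector space of
differential forms all of whose nonzero elements are logarithmic, have no zero at a finite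
point, and have a zero of order `m - 1 = M - 2` at `∞`. -/
structure IsSpaceL (M n : ℕ) (Ω : Submodule (ZMod p) (Form k)) : Prop where
  finite : Module.Finite (ZMod p) Ω
  finrank_eq : Module.finrank (ZMod p) Ω = n
  logarithmic : ∀ ω ∈ Ω, ω ≠ 0 → IsLogarithmic ω
  no_finite_zero : ∀ ω ∈ Ω, ω ≠ 0 → ∀ x : k, ¬ 0 < ordAt x ω
  zero_infty : ∀ ω ∈ Ω, ω ≠ 0 → ordInfty ω = (M : ℤ) - 2

/-- The pair `(Q₁, Q₂)` of polynomials of degree `lam`, all of whose nontrivial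
`𝔽_p`-combinations have degree `lam`, gives rise to the pair of forms
`(dX / (Q₁ Q₂^(p-1) - Q₁^p), dX / (Q₂ Q₁^(p-1) - Q₂^p))`. -/
structure GivesRiseTo (lam : ℕ) (Q₁ Q₂ : k[X]) (ω₁ ω₂ : Form k) : Prop where
  degree_left : Q₁.degree = lam
  degree_right : Q₂.degree = lam
  degree_comb : ∀ i j : ZMod p, (i, j) ≠ (0, 0) → (i • Q₁ + j • Q₂).degree = lam
  left_eq : ω₁ = (algebraMap k[X] (RatFunc k) (Q₁ * Q₂ ^ (p - 1) - Q₁ ^ p))⁻¹ • dX k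
  right_eq : ω₂ = (algebraMap k[X] (RatFunc k) (Q₂ * Q₁ ^ (p - 1) - Q₂ ^ p))⁻¹ • dX k

/-- The pair `(Q₁, Q₂)` is a prompt for the space `Ω`: it gives rise to some `(ω₁, ω₂)`, and for
some `c ≠ 0` the pair `(c Q₁, c Q₂)` gives rise to `(ω₁ / c^p, ω₂ / c^p)`, which is a basis of
`Ω`, a space `L_{lam * p, 2}`. -/
def IsPrompt (lam : ℕ) (Q₁ Q₂ : k[X]) (Ω : Submodule (ZMod p) (Form k)) : Prop :=
  IsSpaceL p (lam * p) 2 Ω ∧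
    ∃ ω₁ ω₂ : Form k, GivesRiseTo p lam Q₁ Q₂ ω₁ ω₂ ∧
      ∃ c : k, c ≠ 0 ∧
        GivesRiseTo p lam (C c * Q₁) (C c * Q₂) ((c ^ p)⁻¹ • ω₁) ((c ^ p)⁻¹ • ω₂) ∧
        LinearIndependent (ZMod p) ![(c ^ p)⁻¹ • ω₁, (c ^ p)⁻¹ • ω₂] ∧
        Submodule.span (ZMod p) {(c ^ p)⁻¹ • ω₁, (c ^ p)⁻¹ • ω₂} = Ω

/-- An automorphism of the projective line over `k`, given by its comorphism `σ` on `k(X)`,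
fixes `∞` if and only if `σ` preserves the order at `∞` (the negative of the degree). -/
def FixesInfty (σ : RatFunc k ≃ₐ[k] RatFunc k) : Prop :=
  ∀ f : RatFunc k, (σ f).intDegree = f.intDegree

/-- The pullback of differential forms along the automorphism with comorphism `σ`:
`f dX ↦ σ(f) d(σ(X))`. -/
def pullback (σ : RatFunc k ≃ₐ[k] RatFunc k) (ω : Form k) : Form k :=
  σ (coeff k ω) • KaehlerDifferential.D k (RatFunc k) (σ RatFunc.X)

/-- `Ω` and `Ω'` are equivalent: `Ω'` is the pullback of `Ω` along an automorphism of the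
projective line fixing `∞`. -/
def AreEquivalent (Ω Ω' : Submodule (ZMod p) (Form k)) : Prop :=
  ∃ σ : RatFunc k ≃ₐ[k] RatFunc k, FixesInfty σ ∧ (Ω' : Set (Form k)) = pullback σ '' Ω

/-- `X⁴ - (a⁴ + a² - 1) X² + 1`. -/
def Qone (a : k) : k[X] := X ^ 4 - C (a ^ 4 + a ^ 2 - 1) * X ^ 2 + 1

/-- `a (X⁴ + (a⁴ - a² - 1) X² + a⁸)`. -/
def Qtwo (a : k) : k[X] := C a * (X ^ 4 + C (a ^ 4 - a ^ 2 - 1) * X ^ 2 + C (a ^ 8))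

end LogForms

end

noncomputable section

namespace LogForms

/-! In characteristic 3 the form `f dX` is logarithmic iff `f'' + f³ = 0`; for `f = 1/P` this reads
`(P²)'' = -1` (`isLogarithmic_inv_iff`).

Every nonzero form of a space `L_{12,2}` is `dX/P` with `deg P = 12`. Comparing the four forms of
the space up to sign, a gcd argument together with residues in `𝔽₃` produces quartics `Q₁, Q₂` as in
the statement (`exists_quartics`). The logarithmic condition becomes the single equation
`wronskianSum Q₁ Q₂ = -1`.

To solve it, write `Q₁ = αA + α³B`, `Q₂ = βA + β³B`, where `α, β` are the leading coefficients, `A`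
is monic and `deg B ≤ 3`. The equation then involves `α, β` only through Dickson invariants
(`wronskianSum_eq`). Second derivatives are polynomials in `X³`, so both sides are cubes; extracting
cube roots leaves a low degree identity whose coefficients can be solved
(`coordinates_of_equation`). After a translation, `A = X⁴ + xX² + z` and `B = y(X² + x)`, with two
relations between `x, y, z` and the invariants.

Those relations say that `v = (x² - z)/y²` is a root of a cubic whose roots are `((α + jβ)² + β²)²`,
`j ∈ 𝔽₃`. Replacing `Q₁` by some `Q₁ + jQ₂`, which keeps the space, gives `v = (α² + β²)²`, and a
homothety then leads to `Qone a`, `Qtwo a` with `a = β/α` (`exists_eq_Qone_Qtwo`).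

Conversely the family satisfies both relations, so its `wronskianSum` is a nonzero constant;
rescaling makes it `-1`, and the scalar is unique up to sign. -/

/-- The derivation `d/dX` of `k(X)`. -/
def ratDeriv (k : Type*) [Field k] : Derivation k (RatFunc k) (RatFunc k) :=
  (coeff k).toLinearMap.compDer (KaehlerDifferential.D k (RatFunc k))

/-! ### The derivation `d/dX` on `k(X)`. -/

section RatDeriv

variable {k : Type*} [Field k]

theorem coeff_dX : coeff k (dX k) = 1 := by
  simpa using coeff_smul_dX (1 : RatFunc k)

theorem coeff_D (F : RatFunc k) :
    coeff k (KaehlerDifferential.D k (RatFunc k) F) = ratDeriv k F := rfl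

theorem eq_coeff_smul_dX (ω : Form k) : ω = coeff k ω • dX k :=
  (coeff k).injective (by rw [coeff_smul_dX])

theorem ratDeriv_X : ratDeriv k RatFunc.X = 1 := coeff_dX

theorem ratDeriv_algebraMap (P : k[X]) :
    ratDeriv k (algebraMap k[X] (RatFunc k) P) = algebraMap k[X] (RatFunc k) (derivative P) := by
  have h (Q : k[X]) : algebraMap k[X] (RatFunc k) Q = aeval RatFunc.X Q := by
    rw [← RatFunc.algebraMap_X, aeval_algebraMap_apply, aeval_X_left_apply]
  rw [h, h, Derivation.map_aeval, ratDeriv_X, smul_eq_mul, mul_one]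

theorem derivation_eq_zero (E : Derivation k (RatFunc k) (RatFunc k))
    (hE : E RatFunc.X = 0) (F : RatFunc k) : E F = 0 := by
  rw [← E.liftKaehlerDifferential_comp_D F,
    eq_coeff_smul_dX (KaehlerDifferential.D k (RatFunc k) F), map_smul, dX,
    E.liftKaehlerDifferential_comp_D, hE, smul_zero]

theorem isLogarithmic_iff_exists (ω : Form k) :
    IsLogarithmic ω ↔ ∃ F : RatFunc k, F ≠ 0 ∧ ratDeriv k F = coeff k ω * F := by
  refine exists_congr fun F => and_congr_right fun hF => ?_
  rw [← (coeff k).injective.eq_iff, map_smul, coeff_D, smul_eq_mul, eq_inv_mul_iff_mul_eq₀ hF,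
    mul_comm, eq_comm]

end RatDeriv

/-! ### Differential criterion for logarithmic forms in characteristic 3. -/

section CharThree

variable {k : Type*} [Field k] [CharP k 3]

theorem three_eq_zero : (3 : k) = 0 := by
  simpa using CharP.cast_eq_zero k 3

theorem three_eq_zero_poly : (3 : k[X]) = 0 := by
  rw [← C_ofNat, three_eq_zero, C_0]

theorem three_eq_zero_ratFunc : (3 : RatFunc k) = 0 := by
  rw [← map_ofNat (algebraMap k (RatFunc k)) 3, three_eq_zero, map_zero]

/-- The mixed terms in the Leibniz rule for the third iterate have coefficient 3, so that iterate is
again a derivation, and it kills `X`. -/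
theorem ratDeriv_ratDeriv_ratDeriv (F : RatFunc k) :
    ratDeriv k (ratDeriv k (ratDeriv k F)) = 0 := by
  let d := ratDeriv k
  let E : Derivation k (RatFunc k) (RatFunc k) :=
    Derivation.mk' (d.toLinearMap ∘ₗ d.toLinearMap ∘ₗ d.toLinearMap) fun f g => by
      simp only [LinearMap.comp_apply, Derivation.coeFn_coe, Derivation.leibniz, smul_eq_mul,
        map_add]
      linear_combination (d f * d (d g) + d g * d (d f)) * three_eq_zero_ratFunc (k := k)
  refine derivation_eq_zero E ?_ F
  simp [E, d, ratDeriv_X]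

theorem isLogarithmic_iff (ω : Form k) :
    IsLogarithmic ω ↔ ratDeriv k (ratDeriv k (coeff k ω)) + coeff k ω ^ 3 = 0 := by
  rw [isLogarithmic_iff_exists]
  set f := coeff k ω
  set d := ratDeriv k with hd
  have h3 := three_eq_zero_ratFunc (k := k)
  constructor
  · rintro ⟨F, hF, h⟩
    have h2 : d (d (d F)) = 0 := ratDeriv_ratDeriv_ratDeriv F
    simp only [h, Derivation.leibniz, smul_eq_mul, map_add] at h2
    refine (mul_eq_zero.1 (?_ : (d (d f) + f ^ 3) * F = 0)).resolve_right hF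
    linear_combination h2 - (f * F * d f) * h3
  · intro h
    by_cases hf : f = 0
    · exact ⟨1, one_ne_zero, by simp [hf]⟩
    by_cases hg : d f = f ^ 2
    · exact ⟨f, hf, by rw [hg, sq]⟩
    -- Up to sign this is `(d - f)²` applied to 1. In characteristic 3, `(d - f)³ = d³ - (f'' + f³)
    -- = 0`, so `d - f` kills it.
    · refine ⟨d f - f ^ 2, sub_ne_zero.2 hg, ?_⟩
      simp only [map_sub, pow_two, Derivation.leibniz, smul_eq_mul]
      linear_combination h - f * d f * h3

theorem isLogarithmic_inv_iff {P : k[X]} (hP : P ≠ 0) {ω : Form k}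
    (hω : coeff k ω = (algebraMap k[X] (RatFunc k) P)⁻¹) :
    IsLogarithmic ω ↔ derivative (derivative (P ^ 2)) = -1 := by
  rw [isLogarithmic_iff, hω]
  have h0 : algebraMap k[X] (RatFunc k) P ≠ 0 := RatFunc.algebraMap_ne_zero hP
  have h3 := three_eq_zero_ratFunc (k := k)
  rw [← (RatFunc.algebraMap_injective k).eq_iff, ← ratDeriv_algebraMap, ← ratDeriv_algebraMap]
  simp only [map_pow, map_neg, map_one]
  set g := algebraMap k[X] (RatFunc k) P
  set d := ratDeriv k
  have e1 : d g⁻¹ = -(g⁻¹ * g⁻¹ * d g) := by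
    rw [Derivation.leibniz_inv, smul_eq_mul, pow_two, neg_mul]
  have key : (d (d g⁻¹) + g⁻¹ ^ 3) * g ^ 3 = d (d (g ^ 2)) + 1 := by
    rw [e1, pow_two g]
    simp only [Derivation.leibniz, smul_eq_mul, map_add, map_neg, e1]
    field_simp
    linear_combination (-g * d (d g)) * h3
  rw [← add_eq_zero_iff_eq_neg, ← key, mul_eq_zero, or_iff_left (pow_ne_zero 3 h0)]

end CharThree

/-! ### Forms without finite zeros are inverses of polynomials. -/

section InversePolynomial

variable {k : Type*} [Field k]

theorem ordAt_nonpos_of_coeff_eq_inv {P : k[X]} (hP : P ≠ 0) {ω : Form k}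
    (h : coeff k ω = (algebraMap k[X] (RatFunc k) P)⁻¹) (x : k) : ¬ 0 < ordAt x ω := by
  have h1 : (coeff k ω).num ∣ 1 := by
    have := RatFunc.num_div_dvd (1 : k[X]) hP
    rwa [map_one, one_div, ← h] at this
  have h2 : (coeff k ω).num.rootMultiplicity x = 0 := by
    refine rootMultiplicity_eq_zero fun hx => ?_
    obtain ⟨q, hq⟩ := h1
    have := congrArg (eval x) hq
    simp [hx.eq_zero] at this
  rw [ordAt, h2]
  simp

theorem ordInfty_of_coeff_eq_inv {P : k[X]} {ω : Form k}
    (h : coeff k ω = (algebraMap k[X] (RatFunc k) P)⁻¹) :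
    ordInfty ω = (P.natDegree : ℤ) - 2 := by
  rw [ordInfty, h, RatFunc.intDegree_inv, RatFunc.intDegree_polynomial, neg_neg]

theorem exists_coeff_eq_inv [IsAlgClosed k] {ω : Form k} (h0 : ω ≠ 0)
    (h : ∀ x : k, ¬ 0 < ordAt x ω) :
    ∃ P : k[X], P ≠ 0 ∧ coeff k ω = (algebraMap k[X] (RatFunc k) P)⁻¹ := by
  set f := coeff k ω with hf
  have hf0 : f ≠ 0 := by simpa [hf] using h0
  have hn0 : f.num ≠ 0 := by simpa using hf0
  have hnr : ∀ x, ¬ f.num.IsRoot x := by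
    intro x hx
    apply h x
    have h1 : 0 < f.num.rootMultiplicity x := (rootMultiplicity_pos hn0).2 hx
    have h2 : f.denom.rootMultiplicity x = 0 := by
      refine rootMultiplicity_eq_zero fun hd => ?_
      obtain ⟨a, b, hab⟩ := f.isCoprime_num_denom
      have := congrArg (eval x) hab
      simp [hx.eq_zero, hd.eq_zero] at this
    rw [ordAt, ← hf, h2]
    simpa using h1
  have hdeg : f.num.degree = 0 := by
    by_contra hd
    obtain ⟨x, hx⟩ := IsAlgClosed.exists_root f.num hd
    exact hnr x hx
  obtain ⟨u, hu⟩ : ∃ u, f.num = C u := ⟨_, eq_C_of_degree_eq_zero hdeg⟩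
  have hu0 : u ≠ 0 := by
    rintro rfl
    exact hn0 (by simpa using hu)
  refine ⟨C u⁻¹ * f.denom, mul_ne_zero (by simpa using hu0) f.denom_ne_zero, ?_⟩
  conv_lhs => rw [← f.num_div_denom, hu]
  have : algebraMap k[X] (RatFunc k) (C u⁻¹) = (algebraMap k[X] (RatFunc k) (C u))⁻¹ := by
    rw [← mul_eq_one_iff_eq_inv₀ (RatFunc.algebraMap_ne_zero (by simpa using hu0)), ← map_mul,
      ← C_mul, inv_mul_cancel₀ hu0, C_1, map_one]
  rw [map_mul, this, mul_inv, inv_inv, div_eq_mul_inv]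

end InversePolynomial

theorem zmod_three_cases (i : ZMod 3) : i = 0 ∨ i = 1 ∨ i = -1 := by
  revert i
  decide

/-! ### From a group of inverse polynomials to a pair of quartics. -/

section CharThree

variable {k : Type*} [Field k] [CharP k 3]

/-- The residue of `dX/P` at a simple root `x` is `1/P'(x)`; this says that it is `±1`. -/
theorem eval_derivative_sq_of_root {P : k[X]} (h : derivative (derivative (P ^ 2)) = -1) {x : k}
    (hx : P.eval x = 0) : (derivative P).eval x ^ 2 = 1 := by
  have := congrArg (eval x) h
  simp only [pow_two, derivative_mul, derivative_add, eval_add, eval_mul, hx, eval_neg, eval_one]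
    at this
  linear_combination -this + (derivative P).eval x ^ 2 * three_eq_zero (k := k)

/-- Two polynomials `P₁, P₂` whose inverses generate a group of forms with simple poles and
residues in `𝔽₃` come from a pair of quartic polynomials. -/
theorem exists_quartics [IsAlgClosed k] {P₁ P₂ P₃ P₄ : k[X]}
    (h₁ : P₁.natDegree = 12) (h₂ : P₂.natDegree = 12) (h₃ : P₃.natDegree = 12)
    (h₄ : P₄.natDegree = 12) (h₁₂ : P₃ * (P₁ + P₂) = P₁ * P₂) (h₂₁ : P₄ * (P₂ - P₁) = P₁ * P₂)
    (hl₁ : derivative (derivative (P₁ ^ 2)) = -1) (hl₂ : derivative (derivative (P₂ ^ 2)) = -1) :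
    ∃ Q₁ Q₂ : k[X], Q₁.degree = 4 ∧ Q₂.degree = 4 ∧ (Q₁ + Q₂).degree = 4 ∧ (Q₁ - Q₂).degree = 4 ∧
      P₁ = Q₁ * Q₂ ^ 2 - Q₁ ^ 3 ∧ P₂ = -(Q₂ * Q₁ ^ 2 - Q₂ ^ 3) := by
  have hP₁ : P₁ ≠ 0 := by rintro rfl; simp at h₁
  have hP₂ : P₂ ≠ 0 := by rintro rfl; simp at h₂
  have h3 := three_eq_zero_poly (k := k)
  obtain ⟨G, R₁, R₂, hR, rfl, rfl⟩ : ∃ G R₁ R₂ : k[X], IsCoprime R₁ R₂ ∧ P₁ = G * R₁ ∧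
      P₂ = G * R₂ := by
    let : GCDMonoid k[X] := UniqueFactorizationMonoid.toGCDMonoid k[X]
    obtain ⟨R₁, R₂, e₁, e₂, hu⟩ := extract_gcd P₁ P₂
    exact ⟨_, R₁, R₂, (gcd_isUnit_iff R₁ R₂).1 hu, e₁, e₂⟩
  have hG : G ≠ 0 := left_ne_zero_of_mul hP₁
  have e₃ : P₃ * (R₁ + R₂) = G * (R₁ * R₂) := mul_left_cancel₀ hG (by linear_combination h₁₂)
  have e₄ : P₄ * (R₂ - R₁) = G * (R₁ * R₂) := mul_left_cancel₀ hG (by linear_combination h₂₁)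
  obtain ⟨a, b, hab⟩ := hR
  -- Both `R₁ ± R₂` are coprime to `R₁R₂` and to each other, so `e₃` and `e₄` force their product to
  -- divide `G`.
  have c₁ : IsCoprime (R₁ + R₂) R₁ := ⟨b, a - b, by linear_combination hab⟩
  have c₂ : IsCoprime (R₁ + R₂) R₂ := ⟨a, b - a, by linear_combination hab⟩
  have c₃ : IsCoprime (R₂ - R₁) R₁ := ⟨b, a + b, by linear_combination hab⟩
  have c₄ : IsCoprime (R₂ - R₁) R₂ := ⟨-a, a + b, by linear_combination hab⟩
  have c₅ : IsCoprime (R₁ + R₂) (R₂ - R₁) :=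
    ⟨-(a + b), a - b, by linear_combination hab - (a * R₁ + b * R₂) * h3⟩
  obtain ⟨H, rfl⟩ : (R₁ + R₂) * (R₂ - R₁) ∣ G := c₅.mul_dvd
    ((c₁.mul_right c₂).dvd_of_dvd_mul_right (Dvd.intro_left _ e₃))
    ((c₃.mul_right c₄).dvd_of_dvd_mul_right (Dvd.intro_left _ e₄))
  have hS : R₁ + R₂ ≠ 0 := by rintro h; simp [h] at hG
  have hT : R₂ - R₁ ≠ 0 := by rintro h; simp [h] at hG
  have hH : H ≠ 0 := right_ne_zero_of_mul hG
  have hR₁ : R₁ ≠ 0 := right_ne_zero_of_mul hP₁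
  have hR₂ : R₂ ≠ 0 := right_ne_zero_of_mul hP₂
  have f₃ : P₃ = (R₂ - R₁) * H * (R₁ * R₂) := mul_right_cancel₀ hS (by linear_combination e₃)
  have f₄ : P₄ = (R₁ + R₂) * H * (R₁ * R₂) := mul_right_cancel₀ hT (by linear_combination e₄)
  rw [f₃, natDegree_mul (mul_ne_zero hT hH) (mul_ne_zero hR₁ hR₂), natDegree_mul hT hH,
    natDegree_mul hR₁ hR₂] at h₃
  rw [f₄, natDegree_mul (mul_ne_zero hS hH) (mul_ne_zero hR₁ hR₂), natDegree_mul hS hH,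
    natDegree_mul hR₁ hR₂] at h₄
  rw [natDegree_mul hG hR₁, natDegree_mul (mul_ne_zero hS hT) hH, natDegree_mul hS hT] at h₁
  rw [natDegree_mul hG hR₂, natDegree_mul (mul_ne_zero hS hT) hH, natDegree_mul hS hT] at h₂
  -- At a root of `H` both residues are `±1`, so `r₁² = r₂²`; then `R₂² - R₁²` vanishes there too
  -- and the root of `P₁` is multiple, contradicting the simple pole.
  have hHdeg : H.degree = 0 := by
    by_contra hd
    obtain ⟨x, hx⟩ := IsAlgClosed.exists_root H hd
    have hx' : H.eval x = 0 := hx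
    have v₁ := eval_derivative_sq_of_root hl₁ (x := x) (by simp [hx'])
    have v₂ := eval_derivative_sq_of_root hl₂ (x := x) (by simp [hx'])
    simp only [derivative_mul, eval_add, eval_mul, eval_sub, hx', derivative_add, derivative_sub]
      at v₁ v₂
    generalize (derivative H).eval x = h at *
    generalize (R₁).eval x = r₁ at *
    generalize (R₂).eval x = r₂ at *
    have w₁ : (h * (r₁ + r₂) * (r₂ - r₁) * r₁) ^ 2 = 1 := by linear_combination v₁
    have w₂ : (h * (r₁ + r₂) * (r₂ - r₁) * r₂) ^ 2 = 1 := by linear_combination v₂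
    have w₃ : (h * (r₁ + r₂) * (r₂ - r₁)) ^ 2 * ((r₁ + r₂) * (r₂ - r₁)) = 0 := by
      linear_combination w₂ - w₁
    rcases mul_eq_zero.1 w₃ with w | w
    · rw [mul_pow, w, zero_mul] at w₁
      exact zero_ne_one w₁
    · rw [mul_assoc h, w, mul_zero, zero_mul, zero_pow two_ne_zero] at w₁
      exact zero_ne_one w₁
  have hHn : H.natDegree = 0 := natDegree_eq_of_degree_eq_some hHdeg
  obtain ⟨h, rfl⟩ : ∃ h, H = C h := ⟨_, eq_C_of_degree_eq_zero hHdeg⟩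
  -- Each `Pᵢ` is `H` times a cubic form in `R₁, R₂`, so a cube root of the constant `H` is absorbed
  -- into the `Rᵢ`. The four degree equations then give degree 4.
  obtain ⟨c, rfl⟩ := IsAlgClosed.exists_pow_nat_eq h (n := 3) (by norm_num)
  have hc : c ≠ 0 := by
    rintro rfl
    simp at hH
  have hdeg (R : k[X]) (hR : R ≠ 0) (hRd : R.natDegree = 4) : (C c * R).degree = 4 := by
    rw [degree_C_mul hc, degree_eq_natDegree hR, hRd]
    rfl
  refine ⟨C c * R₁, C c * R₂, hdeg _ hR₁ (by omega), hdeg _ hR₂ (by omega), ?_, ?_, ?_, ?_⟩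
  · rw [← mul_add]
    exact hdeg _ hS (by omega)
  · rw [← neg_sub, ← mul_sub, degree_neg]
    exact hdeg _ hT (by omega)
  · rw [C_pow]
    ring
  · rw [C_pow]
    ring

end CharThree

/-! ### Quartic pairs and the forms attached to them. -/

/-- The form `dX / (Q₁ Q₂² - Q₁³)`. -/
def baseForm {k : Type*} [Field k] (Q₁ Q₂ : k[X]) : Form k :=
  (algebraMap k[X] (RatFunc k) (Q₁ * Q₂ ^ 2 - Q₁ ^ 3))⁻¹ • dX k

/-- `Q₁`, `Q₂`, `Q₁ + Q₂` and `Q₁ - Q₂` have degree `4`. -/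
structure IsQuarticPair {k : Type*} [Field k] (Q₁ Q₂ : k[X]) : Prop where
  left : Q₁.degree = 4
  right : Q₂.degree = 4
  add : (Q₁ + Q₂).degree = 4
  sub : (Q₁ - Q₂).degree = 4

/-- The invariant expression `Q₁³ (Q₁ Q₂²)'' + Q₂³ (Q₁² Q₂)''`, which is the second derivative of
`(Q₁ Q₂² - Q₁³)²` in characteristic `3`. -/
def wronskianSum {k : Type*} [Field k] (Q₁ Q₂ : k[X]) : k[X] :=
  Q₁ ^ 3 * derivative (derivative (Q₁ * Q₂ ^ 2)) + Q₂ ^ 3 * derivative (derivative (Q₁ ^ 2 * Q₂))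

section Basic

variable {k : Type*} [Field k]

theorem wronskianSum_comm (Q₁ Q₂ : k[X]) : wronskianSum Q₂ Q₁ = wronskianSum Q₁ Q₂ := by
  rw [wronskianSum, wronskianSum, mul_comm Q₂, mul_comm (Q₂ ^ 2), add_comm]

theorem wronskianSum_C_mul (c : k) (Q₁ Q₂ : k[X]) :
    wronskianSum (C c * Q₁) (C c * Q₂) = C (c ^ 6) * wronskianSum Q₁ Q₂ := by
  have h₁ : C c * Q₁ * (C c * Q₂) ^ 2 = C (c ^ 3) * (Q₁ * Q₂ ^ 2) := by rw [C_pow]; ring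
  have h₂ : (C c * Q₁) ^ 2 * (C c * Q₂) = C (c ^ 3) * (Q₁ ^ 2 * Q₂) := by rw [C_pow]; ring
  rw [wronskianSum, wronskianSum, h₁, h₂]
  simp only [derivative_C_mul]
  simp only [C_pow]
  ring

theorem IsQuarticPair.symm {Q₁ Q₂ : k[X]} (h : IsQuarticPair Q₁ Q₂) : IsQuarticPair Q₂ Q₁ :=
  ⟨h.right, h.left, by rw [add_comm, h.add], by rw [← neg_sub, degree_neg, h.sub]⟩

theorem IsQuarticPair.C_mul {Q₁ Q₂ : k[X]} (h : IsQuarticPair Q₁ Q₂) {c : k} (hc : c ≠ 0) :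
    IsQuarticPair (C c * Q₁) (C c * Q₂) := by
  constructor
  · rw [degree_C_mul hc, h.left]
  · rw [degree_C_mul hc, h.right]
  · rw [← mul_add, degree_C_mul hc, h.add]
  · rw [← mul_sub, degree_C_mul hc, h.sub]

theorem ne_zero_of_degree_eq_four {Q : k[X]} (h : Q.degree = 4) : Q ≠ 0 := by
  rintro rfl
  simp at h

theorem natDegree_of_degree_eq_four {Q : k[X]} (h : Q.degree = 4) : Q.natDegree = 4 :=
  natDegree_eq_of_degree_eq_some h

theorem coeff_baseForm (Q₁ Q₂ : k[X]) :
    coeff k (baseForm Q₁ Q₂) = (algebraMap k[X] (RatFunc k) (Q₁ * Q₂ ^ 2 - Q₁ ^ 3))⁻¹ :=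
  coeff_smul_dX _

theorem algebraMap_smul_form (c : k) (ω : Form k) : c • ω = algebraMap k (RatFunc k) c • ω :=
  (algebraMap_smul (RatFunc k) c ω).symm

theorem inv_pow_three_smul_baseForm (c : k) (Q₁ Q₂ : k[X]) :
    (c ^ 3)⁻¹ • baseForm Q₁ Q₂ = baseForm (C c * Q₁) (C c * Q₂) := by
  rw [algebraMap_smul_form, baseForm, baseForm, smul_smul]
  congr 1
  have : C c * Q₁ * (C c * Q₂) ^ 2 - (C c * Q₁) ^ 3 = C (c ^ 3) * (Q₁ * Q₂ ^ 2 - Q₁ ^ 3) := by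
    rw [C_pow]; ring
  rw [this, map_mul, mul_inv, map_inv₀]
  congr 2

theorem IsQuarticPair.natDegree_eq {Q₁ Q₂ : k[X]} (h : IsQuarticPair Q₁ Q₂) :
    Q₁ * Q₂ ^ 2 - Q₁ ^ 3 ≠ 0 ∧ (Q₁ * Q₂ ^ 2 - Q₁ ^ 3).natDegree = 12 := by
  have h₁ := ne_zero_of_degree_eq_four h.left
  have h₃ := ne_zero_of_degree_eq_four h.add
  have h₄ := ne_zero_of_degree_eq_four h.symm.sub
  have e : Q₁ * Q₂ ^ 2 - Q₁ ^ 3 = Q₁ * (Q₁ + Q₂) * (Q₂ - Q₁) := by ring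
  rw [e]
  refine ⟨mul_ne_zero (mul_ne_zero h₁ h₃) h₄, ?_⟩
  rw [natDegree_mul (mul_ne_zero h₁ h₃) h₄, natDegree_mul h₁ h₃,
    natDegree_of_degree_eq_four h.left, natDegree_of_degree_eq_four h.add,
    natDegree_of_degree_eq_four h.symm.sub]

/-- The coefficient of the form is the inverse of a polynomial of degree `12`. -/
def IsInvDegreeTwelve (ω : Form k) : Prop :=
  ∃ P : k[X], P ≠ 0 ∧ P.natDegree = 12 ∧ coeff k ω = (algebraMap k[X] (RatFunc k) P)⁻¹

theorem IsInvDegreeTwelve.neg {ω : Form k} (h : IsInvDegreeTwelve ω) : IsInvDegreeTwelve (-ω) := by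
  obtain ⟨P, h0, h1, h2⟩ := h
  exact ⟨-P, neg_ne_zero.2 h0, by rw [natDegree_neg, h1], by rw [map_neg, h2, map_neg, inv_neg]⟩

theorem IsInvDegreeTwelve.ne_zero {ω : Form k} (h : IsInvDegreeTwelve ω) : ω ≠ 0 := by
  obtain ⟨P, h0, h1, h2⟩ := h
  rintro rfl
  rw [map_zero, eq_comm, inv_eq_zero] at h2
  exact RatFunc.algebraMap_ne_zero h0 h2

theorem IsQuarticPair.isInvDegreeTwelve {Q₁ Q₂ : k[X]} (h : IsQuarticPair Q₁ Q₂) :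
    IsInvDegreeTwelve (baseForm Q₁ Q₂) :=
  ⟨_, h.natDegree_eq.1, h.natDegree_eq.2, coeff_baseForm _ _⟩

theorem IsQuarticPair.coeff_baseForm_sub {Q₁ Q₂ : k[X]} (h : IsQuarticPair Q₁ Q₂) :
    coeff k (baseForm Q₁ Q₂ - baseForm Q₂ Q₁) =
      (algebraMap k[X] (RatFunc k) (Q₁ * Q₂ * (Q₂ - Q₁)))⁻¹ := by
  rw [map_sub, coeff_baseForm, coeff_baseForm]
  have e₁ : Q₁ * Q₂ ^ 2 - Q₁ ^ 3 = Q₁ * (Q₁ + Q₂) * (Q₂ - Q₁) := by ring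
  have e₂ : Q₂ * Q₁ ^ 2 - Q₂ ^ 3 = -(Q₂ * (Q₁ + Q₂) * (Q₂ - Q₁)) := by ring
  have i := fun {Q : k[X]} (h : Q ≠ 0) => RatFunc.algebraMap_ne_zero (K := k) h
  have i₁ := i (ne_zero_of_degree_eq_four h.left)
  have i₂ := i (ne_zero_of_degree_eq_four h.right)
  have i₃ := i (ne_zero_of_degree_eq_four h.add)
  have i₄ := i (ne_zero_of_degree_eq_four h.symm.sub)
  rw [e₁, e₂]
  simp only [map_mul, map_neg]
  field_simp
  rw [map_add]
  ring

theorem IsQuarticPair.isInvDegreeTwelve_sub {Q₁ Q₂ : k[X]} (h : IsQuarticPair Q₁ Q₂) :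
    IsInvDegreeTwelve (baseForm Q₁ Q₂ - baseForm Q₂ Q₁) := by
  have h₁ := ne_zero_of_degree_eq_four h.left
  have h₂ := ne_zero_of_degree_eq_four h.right
  have h₄ := ne_zero_of_degree_eq_four h.symm.sub
  refine ⟨Q₁ * Q₂ * (Q₂ - Q₁), mul_ne_zero (mul_ne_zero h₁ h₂) h₄, ?_, h.coeff_baseForm_sub⟩
  rw [natDegree_mul (mul_ne_zero h₁ h₂) h₄, natDegree_mul h₁ h₂,
    natDegree_of_degree_eq_four h.left, natDegree_of_degree_eq_four h.right,
    natDegree_of_degree_eq_four h.symm.sub]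

/-- Changing the sign of `Q₂` fixes the first form and negates the second, so the case of
differences applies. -/
theorem IsQuarticPair.isInvDegreeTwelve_add {Q₁ Q₂ : k[X]} (h : IsQuarticPair Q₁ Q₂) :
    IsInvDegreeTwelve (baseForm Q₁ Q₂ + baseForm Q₂ Q₁) := by
  have h' : IsQuarticPair Q₁ (-Q₂) :=
    ⟨h.left, by rw [degree_neg, h.right], by rw [← sub_eq_add_neg, h.sub],
      by rw [sub_neg_eq_add, h.add]⟩
  have e₁ : baseForm Q₁ (-Q₂) = baseForm Q₁ Q₂ := by
    rw [baseForm, baseForm, neg_sq]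
  have e₂ : baseForm (-Q₂) Q₁ = -baseForm Q₂ Q₁ := by
    rw [baseForm, baseForm, ← neg_smul, ← inv_neg, ← map_neg]
    congr 3
    ring
  simpa [e₁, e₂] using h'.isInvDegreeTwelve_sub

theorem IsInvDegreeTwelve.ordInfty_eq {ω : Form k} (h : IsInvDegreeTwelve ω) :
    ordInfty ω = ((12 : ℕ) : ℤ) - 2 := by
  obtain ⟨P, h0, h1, h2⟩ := h
  rw [ordInfty_of_coeff_eq_inv h2, h1]

theorem IsInvDegreeTwelve.ordAt_nonpos {ω : Form k} (h : IsInvDegreeTwelve ω) (x : k) :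
    ¬ 0 < ordAt x ω := by
  obtain ⟨P, h0, h1, h2⟩ := h
  exact ordAt_nonpos_of_coeff_eq_inv h0 h2 x

end Basic

/-! ### The logarithmic condition for quartic pairs. -/

section CharThree

variable {k : Type*} [Field k] [CharP k 3]

theorem derivative_derivative_cube_mul (A B : k[X]) :
    derivative (derivative (A ^ 3 * B)) = A ^ 3 * derivative (derivative B) := by
  have h : derivative (A ^ 3) = 0 := by
    rw [derivative_pow]
    simp [three_eq_zero]
  simp [derivative_mul, h]

theorem derivative_derivative_sq (Q₁ Q₂ : k[X]) :
    derivative (derivative ((Q₁ * Q₂ ^ 2 - Q₁ ^ 3) ^ 2)) = wronskianSum Q₁ Q₂ := by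
  have e : (Q₁ * Q₂ ^ 2 - Q₁ ^ 3) ^ 2 =
      Q₁ ^ 3 * (Q₁ * Q₂ ^ 2) + Q₂ ^ 3 * (Q₁ ^ 2 * Q₂) + (Q₁ ^ 2) ^ 3 * 1 := by
    linear_combination (-Q₁ ^ 4 * Q₂ ^ 2) * three_eq_zero_poly (k := k)
  rw [e, derivative_add, derivative_add, derivative_add, derivative_add,
    derivative_derivative_cube_mul, derivative_derivative_cube_mul,
    derivative_derivative_cube_mul, wronskianSum]
  simp

theorem isLogarithmic_zero : IsLogarithmic (0 : Form k) := by
  rw [isLogarithmic_iff]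
  simp

theorem IsLogarithmic.neg {ω : Form k} (h : IsLogarithmic ω) : IsLogarithmic (-ω) := by
  rw [isLogarithmic_iff] at *
  simp only [map_neg]
  linear_combination -h

/-- The criterion `f'' + f³ = 0` is additive because cubing is. -/
theorem IsLogarithmic.add {ω ω' : Form k} (h : IsLogarithmic ω) (h' : IsLogarithmic ω') :
    IsLogarithmic (ω + ω') := by
  rw [isLogarithmic_iff] at *
  simp only [map_add]
  linear_combination h + h' + (coeff k ω ^ 2 * coeff k ω' + coeff k ω * coeff k ω' ^ 2) *
    three_eq_zero_ratFunc (k := k)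

theorem isLogarithmic_baseForm_iff {Q₁ Q₂ : k[X]} (h : IsQuarticPair Q₁ Q₂) :
    IsLogarithmic (baseForm Q₁ Q₂) ↔ wronskianSum Q₁ Q₂ = -1 := by
  rw [isLogarithmic_inv_iff h.natDegree_eq.1 (coeff_baseForm Q₁ Q₂), derivative_derivative_sq]

end CharThree

/-! ### Spaces over `𝔽₃` and their quartic pairs. -/

section PrimeField

variable {k : Type*} [Field k] [Algebra (ZMod 3) k]

theorem IsQuarticPair.degree_comb {Q₁ Q₂ : k[X]} (h : IsQuarticPair Q₁ Q₂) (i j : ZMod 3)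
    (hij : (i, j) ≠ (0, 0)) : (i • Q₁ + j • Q₂).degree = 4 := by
  have e₁ : -Q₁ + Q₂ = -(Q₁ - Q₂) := by ring
  have e₂ : -Q₁ + -Q₂ = -(Q₁ + Q₂) := by ring
  have e₃ : Q₁ + -Q₂ = Q₁ - Q₂ := by ring
  rcases zmod_three_cases i with rfl | rfl | rfl <;>
    rcases zmod_three_cases j with rfl | rfl | rfl <;>
    simp only [zero_smul, one_smul, neg_smul, zero_add, add_zero, e₁, e₂, e₃,
      degree_neg]
  · exact (hij rfl).elim
  exacts [h.right, h.right, h.left, h.add, h.sub, h.left, h.sub, h.add]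

theorem IsQuarticPair.isInvDegreeTwelve_comb {Q₁ Q₂ : k[X]} (h : IsQuarticPair Q₁ Q₂)
    (i j : ZMod 3) (hij : (i, j) ≠ (0, 0)) :
    IsInvDegreeTwelve (i • baseForm Q₁ Q₂ + j • baseForm Q₂ Q₁) := by
  set ω₁ := baseForm Q₁ Q₂ with h₁
  set ω₂ := baseForm Q₂ Q₁ with h₂
  have n₁ := h.isInvDegreeTwelve
  have n₂ := h.symm.isInvDegreeTwelve
  have n₃ := h.isInvDegreeTwelve_add
  have n₄ := h.isInvDegreeTwelve_sub
  rw [← h₁, ← h₂] at n₃ n₄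
  rw [← h₁] at n₁
  rw [← h₂] at n₂
  have e₁ : -ω₁ + ω₂ = -(ω₁ - ω₂) := by abel
  have e₂ : -ω₁ + -ω₂ = -(ω₁ + ω₂) := by abel
  rcases zmod_three_cases i with rfl | rfl | rfl <;>
    rcases zmod_three_cases j with rfl | rfl | rfl <;>
    simp only [zero_smul, one_smul, neg_smul, zero_add, add_zero, e₁, e₂, ← sub_eq_add_neg]
  · exact (hij rfl).elim
  exacts [n₂, n₂.neg, n₁, n₃, n₄, n₁.neg, n₄.neg, n₃.neg]

theorem IsQuarticPair.linearIndependent {Q₁ Q₂ : k[X]} (h : IsQuarticPair Q₁ Q₂) :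
    LinearIndependent (ZMod 3) ![baseForm Q₁ Q₂, baseForm Q₂ Q₁] := by
  rw [LinearIndependent.pair_iff]
  intro i j hij
  by_contra hne
  exact (h.isInvDegreeTwelve_comb i j (by simpa using hne)).ne_zero hij

variable [CharP k 3]

theorem isLogarithmic_comb {ω₁ ω₂ : Form k} (h₁ : IsLogarithmic ω₁) (h₂ : IsLogarithmic ω₂)
    (i j : ZMod 3) : IsLogarithmic (i • ω₁ + j • ω₂) := by
  have (i : ZMod 3) {ω : Form k} (h : IsLogarithmic ω) : IsLogarithmic (i • ω) := by
    rcases zmod_three_cases i with rfl | rfl | rfl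
    · rw [zero_smul]
      exact isLogarithmic_zero
    · rwa [one_smul]
    · rw [neg_smul, one_smul]
      exact h.neg
  exact (this i h₁).add (this j h₂)

theorem IsQuarticPair.isSpaceL {Q₁ Q₂ : k[X]} (h : IsQuarticPair Q₁ Q₂)
    (hw : wronskianSum Q₁ Q₂ = -1) :
    IsSpaceL 3 12 2 (Submodule.span (ZMod 3) {baseForm Q₁ Q₂, baseForm Q₂ Q₁}) := by
  have hl₁ := (isLogarithmic_baseForm_iff h).2 hw
  have hl₂ := (isLogarithmic_baseForm_iff h.symm).2 (by rw [wronskianSum_comm, hw])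
  have key : ∀ ω ∈ Submodule.span (ZMod 3) {baseForm Q₁ Q₂, baseForm Q₂ Q₁}, ω ≠ 0 →
      IsLogarithmic ω ∧ IsInvDegreeTwelve ω := by
    intro ω hω h0
    obtain ⟨i, j, rfl⟩ := Submodule.mem_span_pair.1 hω
    refine ⟨isLogarithmic_comb hl₁ hl₂ i j, h.isInvDegreeTwelve_comb i j ?_⟩
    rintro hij
    obtain ⟨rfl, rfl⟩ := Prod.mk.inj hij
    simp at h0
  refine ⟨Module.Finite.span_of_finite _ (Set.toFinite _), ?_, fun ω hω h0 => (key ω hω h0).1,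
    fun ω hω h0 => (key ω hω h0).2.ordAt_nonpos, fun ω hω h0 => (key ω hω h0).2.ordInfty_eq⟩
  have := finrank_span_eq_card h.linearIndependent
  rwa [Matrix.range_cons, Matrix.range_cons, Matrix.range_empty, Set.union_empty,
    Set.singleton_union] at this

/-- The only freedom left in a prompt is the scalar `c`, subject to one equation, since
`wronskianSum` is homogeneous of degree 6. -/
theorem isPrompt_iff {Q₁ Q₂ : k[X]} (h : IsQuarticPair Q₁ Q₂) (Ω : Submodule (ZMod 3) (Form k)) :
    IsPrompt 3 4 Q₁ Q₂ Ω ↔ ∃ c : k, c ≠ 0 ∧ c ^ 6 • wronskianSum Q₁ Q₂ = -1 ∧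
      Ω = Submodule.span (ZMod 3) {baseForm (C c * Q₁) (C c * Q₂),
        baseForm (C c * Q₂) (C c * Q₁)} := by
  constructor
  · rintro ⟨hS, ω₁, ω₂, hg, c, hc, -, -, hs⟩
    obtain rfl : ω₁ = baseForm Q₁ Q₂ := hg.left_eq
    obtain rfl : ω₂ = baseForm Q₂ Q₁ := hg.right_eq
    rw [inv_pow_three_smul_baseForm, inv_pow_three_smul_baseForm] at hs
    refine ⟨c, hc, ?_, hs.symm⟩
    rw [smul_eq_C_mul, ← wronskianSum_C_mul, ← isLogarithmic_baseForm_iff (h.C_mul hc)]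
    exact hS.logarithmic _ (hs ▸ Submodule.subset_span (by simp))
      (h.C_mul hc).isInvDegreeTwelve.ne_zero
  · rintro ⟨c, hc, hw, rfl⟩
    rw [smul_eq_C_mul, ← wronskianSum_C_mul] at hw
    have g {Q₁ Q₂ : k[X]} (h : IsQuarticPair Q₁ Q₂) :
        GivesRiseTo 3 4 Q₁ Q₂ (baseForm Q₁ Q₂) (baseForm Q₂ Q₁) :=
      ⟨h.left, h.right, h.degree_comb, rfl, rfl⟩
    refine ⟨(h.C_mul hc).isSpaceL hw, _, _, g h, c, hc, ?_, ?_, ?_⟩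
    · rw [inv_pow_three_smul_baseForm, inv_pow_three_smul_baseForm]
      exact g (h.C_mul hc)
    · rw [inv_pow_three_smul_baseForm, inv_pow_three_smul_baseForm]
      exact (h.C_mul hc).linearIndependent
    · rw [inv_pow_three_smul_baseForm, inv_pow_three_smul_baseForm]

/-- Every space `L_{12,2}` comes from a pair of quartic polynomials. -/
theorem exists_isQuarticPair [IsAlgClosed k] {Ω : Submodule (ZMod 3) (Form k)}
    (h : IsSpaceL 3 12 2 Ω) :
    ∃ Q₁ Q₂ : k[X], IsQuarticPair Q₁ Q₂ ∧ wronskianSum Q₁ Q₂ = -1 ∧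
      Ω = Submodule.span (ZMod 3) {baseForm Q₁ Q₂, baseForm Q₂ Q₁} := by
  have := h.finite
  let b := Module.finBasisOfFinrankEq (ZMod 3) Ω h.finrank_eq
  have hb (i j : ZMod 3) (hij : i • (b 0 : Form k) + j • (b 1 : Form k) = 0) :
      i = 0 ∧ j = 0 := by
    have := LinearIndependent.pair_iff (R := ZMod 3) (x := b 0) (y := b 1)
    exact this.1 (by convert! b.linearIndependent using 1; ext i; fin_cases i <;> rfl) i j (Subtype.ext hij)
  have key (i j : ZMod 3) (hij : ¬(i = 0 ∧ j = 0)) : ∃ P : k[X], P.natDegree = 12 ∧ P ≠ 0 ∧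
      coeff k (i • (b 0 : Form k) + j • (b 1 : Form k)) = (algebraMap k[X] (RatFunc k) P)⁻¹ ∧
      derivative (derivative (P ^ 2)) = -1 := by
    have h0 : i • (b 0 : Form k) + j • (b 1 : Form k) ≠ 0 := fun e => hij (hb i j e)
    have hm : i • (b 0 : Form k) + j • (b 1 : Form k) ∈ Ω :=
      add_mem (Ω.smul_mem _ (b 0).2) (Ω.smul_mem _ (b 1).2)
    obtain ⟨P, hP, hc⟩ := exists_coeff_eq_inv h0 (h.no_finite_zero _ hm h0)
    refine ⟨P, ?_, hP, hc, (isLogarithmic_inv_iff hP hc).1 (h.logarithmic _ hm h0)⟩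
    have := h.zero_infty _ hm h0
    rw [ordInfty_of_coeff_eq_inv hc] at this
    omega
  obtain ⟨P₁, d₁, n₁, c₁, l₁⟩ := key 1 0 (by decide)
  obtain ⟨P₂, d₂, n₂, c₂, l₂⟩ := key 0 1 (by decide)
  obtain ⟨P₃, d₃, n₃, c₃, -⟩ := key 1 1 (by decide)
  obtain ⟨P₄, d₄, n₄, c₄, -⟩ := key 1 (-1) (by decide)
  simp only [one_smul, zero_smul, neg_smul, add_zero, zero_add, map_add, map_neg] at c₁ c₂ c₃ c₄
  rw [c₁, c₂] at c₃ c₄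
  have i := fun {Q : k[X]} (h : Q ≠ 0) => RatFunc.algebraMap_ne_zero (K := k) h
  have i₁ := i n₁
  have i₂ := i n₂
  have i₃ := i n₃
  have i₄ := i n₄
  have r₃ : P₃ * (P₁ + P₂) = P₁ * P₂ := by
    apply RatFunc.algebraMap_injective k
    simp only [map_mul, map_add]
    field_simp at c₃
    linear_combination c₃
  have r₄ : P₄ * (P₂ - P₁) = P₁ * P₂ := by
    apply RatFunc.algebraMap_injective k
    simp only [map_mul, map_sub]
    field_simp at c₄
    linear_combination c₄
  obtain ⟨Q₁, Q₂, q₁, q₂, q₃, q₄, e₁, e₂⟩ := exists_quartics d₁ d₂ d₃ d₄ r₃ r₄ l₁ l₂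
  have hb₁ : (b 0 : Form k) = baseForm Q₁ Q₂ := by
    rw [eq_coeff_smul_dX (b 0 : Form k), c₁, e₁, baseForm]
  -- The sign comes from `P₂ = -(Q₂Q₁² - Q₂³)`; it does not affect the span.
  have hb₂ : (b 1 : Form k) = -baseForm Q₂ Q₁ := by
    rw [eq_coeff_smul_dX (b 1 : Form k), c₂, e₂, baseForm, map_neg, inv_neg, neg_smul]
  refine ⟨Q₁, Q₂, ⟨q₁, q₂, q₃, q₄⟩, by rw [← derivative_derivative_sq, ← e₁, l₁], ?_⟩
  apply le_antisymm
  · intro ω hω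
    have := b.sum_repr ⟨ω, hω⟩
    rw [Fin.sum_univ_two] at this
    have := congrArg Subtype.val this
    simp only [Submodule.coe_add, Submodule.coe_smul, hb₁, hb₂] at this
    rw [← this]
    exact Submodule.mem_span_pair.2 ⟨_, _, by rw [smul_neg, ← neg_smul]⟩
  · rw [Submodule.span_le, Set.insert_subset_iff, Set.singleton_subset_iff]
    exact ⟨hb₁ ▸ (b 0).2, by simpa [hb₂] using (b 1).2⟩

end PrimeField

/-! ### Solving the equation `wronskianSum Q₁ Q₂ = -1`. -/

section Solve

section Affine

variable {k : Type*} [Field k]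

theorem wronskianSum_comp (r s : k) (Q₁ Q₂ : k[X]) :
    wronskianSum (Q₁.comp (C r * X + C s)) (Q₂.comp (C r * X + C s)) =
      C (r ^ 2) * (wronskianSum Q₁ Q₂).comp (C r * X + C s) := by
  have h (Q : k[X]) : derivative (derivative (Q.comp (C r * X + C s))) =
      C (r ^ 2) * (derivative (derivative Q)).comp (C r * X + C s) := by
    simp only [derivative_comp, derivative_mul, derivative_add, derivative_C, derivative_X,
      zero_mul, mul_one, add_zero, zero_add, C_pow]
    ring
  simp only [wronskianSum, ← mul_comp, ← pow_comp, h, add_comp]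
  simp only [mul_comp, pow_comp]
  ring

theorem degree_comp_affine {r : k} (hr : r ≠ 0) (s : k) (Q : k[X]) :
    (Q.comp (C r * X + C s)).degree = Q.degree := by
  by_cases hQ : Q = 0
  · simp [hQ]
  have hd : (C r * X + C s : k[X]).natDegree = 1 := natDegree_linear hr
  rw [degree_eq_natDegree hQ, degree_eq_natDegree, natDegree_comp, hd, mul_one]
  rw [Ne, comp_eq_zero_iff]
  rintro (h | ⟨-, h⟩)
  · exact hQ h
  · rw [h, natDegree_C] at hd
    exact zero_ne_one hd

theorem IsQuarticPair.comp {Q₁ Q₂ : k[X]} (h : IsQuarticPair Q₁ Q₂) {r : k} (hr : r ≠ 0) (s : k) :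
    IsQuarticPair (Q₁.comp (C r * X + C s)) (Q₂.comp (C r * X + C s)) := by
  constructor
  · rw [degree_comp_affine hr, h.left]
  · rw [degree_comp_affine hr, h.right]
  · rw [← add_comp, degree_comp_affine hr, h.add]
  · rw [← sub_comp, degree_comp_affine hr, h.sub]

end Affine

variable {k : Type*} [Field k] [CharP k 3]

/-- Cubes are constants for the derivation, so the pure cubes drop out of the binary cubic. -/
theorem derivative_derivative_combination (A B a b c d : k[X]) (p q r s : k)
    (ha : a = C p) (hb : b = C q) (hc : c = C r) (hd : d = C s) :
    derivative (derivative (a * A ^ 3 + b * (A ^ 2 * B) + c * (A * B ^ 2) + d * B ^ 3)) =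
      b * derivative (derivative (A ^ 2 * B)) + c * derivative (derivative (A * B ^ 2)) := by
  have h (A : k[X]) : derivative (derivative (A ^ 3)) = 0 := by
    simpa using derivative_derivative_cube_mul A 1
  subst ha hb hc hd
  simp only [derivative_add, derivative_C_mul, h]
  ring

/-- The wronskian sum in terms of the coordinates with respect to the vectors `(α, β)` and
`(α³, β³)`, whose coefficients are Dickson invariants of `(α, β)`. -/
theorem wronskianSum_eq (A B : k[X]) (α β : k) :
    wronskianSum (C α * A + C (α ^ 3) * B) (C β * A + C (β ^ 3) * B) =
      C ((α * β ^ 3 - α ^ 3 * β) ^ 2) *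
        ((A ^ 3 + C ((α ^ 2 + β ^ 2) * (α ^ 4 + β ^ 4)) * B ^ 3) *
            derivative (derivative (A ^ 2 * B)) -
          C ((α * β ^ 3 - α ^ 3 * β) ^ 2) * B ^ 3 * derivative (derivative (A * B ^ 2))) := by
  have h₁ : (C α * A + C (α ^ 3) * B) * (C β * A + C (β ^ 3) * B) ^ 2 =
      C (α * β ^ 2) * A ^ 3 + C (α ^ 3 * β ^ 2 + 2 * α * β ^ 4) * (A ^ 2 * B) +
        C (2 * α ^ 3 * β ^ 4 + α * β ^ 6) * (A * B ^ 2) + C (α ^ 3 * β ^ 6) * B ^ 3 := by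
    simp only [C_add, C_mul, C_pow, C_ofNat]
    ring
  have h₂ : (C α * A + C (α ^ 3) * B) ^ 2 * (C β * A + C (β ^ 3) * B) =
      C (β * α ^ 2) * A ^ 3 + C (β ^ 3 * α ^ 2 + 2 * β * α ^ 4) * (A ^ 2 * B) +
        C (2 * β ^ 3 * α ^ 4 + β * α ^ 6) * (A * B ^ 2) + C (β ^ 3 * α ^ 6) * B ^ 3 := by
    simp only [C_add, C_mul, C_pow, C_ofNat]
    ring
  rw [wronskianSum, h₁, h₂, derivative_derivative_combination _ _ _ _ _ _ _ _ _ _ rfl rfl rfl rfl,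
    derivative_derivative_combination _ _ _ _ _ _ _ _ _ _ rfl rfl rfl rfl]
  generalize derivative (derivative (A ^ 2 * B)) = D₁
  generalize derivative (derivative (A * B ^ 2)) = D₂
  simp only [C_add, C_sub, C_mul, C_pow, C_ofNat]
  generalize C α = α
  generalize C β = β
  grind

/-- Since `(Xⁿ)'' = n(n-1)Xⁿ⁻²`, only exponents `n ≡ 2 mod 3` survive, with factor `2 = -1`; hence a
polynomial in `X³` built from the coefficients of `X¹¹, X⁸, X⁵, X²`. -/
theorem derivative_derivative_sq_mul (x₂ x₁ x₀ y₃ y₂ y₁ y₀ : k) :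
    derivative (derivative ((X ^ 4 + C x₂ * X ^ 2 + C x₁ * X + C x₀) ^ 2 *
        (C y₃ * X ^ 3 + C y₂ * X ^ 2 + C y₁ * X + C y₀))) =
      -(C y₃ * X ^ 9 + C (y₀ + 2 * x₂ * y₂ + 2 * x₁ * y₃) * X ^ 6 +
        C ((2 * x₀ + x₂ ^ 2) * y₁ + 2 * x₁ * y₀ + 2 * x₁ * x₂ * y₂ +
          (2 * x₀ * x₂ + x₁ ^ 2) * y₃) * X ^ 3 +
        C (y₂ * x₀ ^ 2 + 2 * x₁ * x₀ * y₁ + (2 * x₂ * x₀ + x₁ ^ 2) * y₀)) := by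
  simp only [derivative_mul, derivative_add, derivative_C, derivative_X_pow, derivative_X,
    pow_two (X ^ 4 + C x₂ * X ^ 2 + C x₁ * X + C x₀), zero_mul, zero_add, add_zero, mul_one,
    C_add, C_mul, C_pow, C_ofNat, map_natCast, derivative_natCast, Nat.reduceSub]
  push_cast
  generalize C x₂ = x₂
  generalize C x₁ = x₁
  generalize C x₀ = x₀
  generalize C y₃ = y₃
  generalize C y₂ = y₂
  generalize C y₁ = y₁
  generalize C y₀ = y₀
  generalize (X : k[X]) = X
  grind

theorem derivative_derivative_mul_sq (x₂ x₁ x₀ y₃ y₂ y₁ y₀ : k) :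
    derivative (derivative ((X ^ 4 + C x₂ * X ^ 2 + C x₁ * X + C x₀) *
        (C y₃ * X ^ 3 + C y₂ * X ^ 2 + C y₁ * X + C y₀) ^ 2)) =
      -(C (y₂ ^ 2 + 2 * y₁ * y₃ + x₂ * y₃ ^ 2) * X ^ 6 +
        C (2 * y₀ * y₁ + x₂ * (2 * y₃ * y₀ + 2 * y₂ * y₁) + x₁ * (2 * y₃ * y₁ + y₂ ^ 2) +
          2 * x₀ * y₃ * y₂) * X ^ 3 +
        C (x₀ * (2 * y₀ * y₂ + y₁ ^ 2) + 2 * x₁ * y₀ * y₁ + x₂ * y₀ ^ 2)) := by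
  simp only [derivative_mul, derivative_add, derivative_C, derivative_X_pow, derivative_X,
    pow_two (C y₃ * X ^ 3 + C y₂ * X ^ 2 + C y₁ * X + C y₀), zero_mul, zero_add, add_zero, mul_one,
    C_add, C_mul, C_pow, C_ofNat, map_natCast, derivative_natCast, Nat.reduceSub]
  push_cast
  generalize C x₂ = x₂
  generalize C x₁ = x₁
  generalize C x₀ = x₀
  generalize C y₃ = y₃
  generalize C y₂ = y₂
  generalize C y₁ = y₁
  generalize C y₀ = y₀
  generalize (X : k[X]) = X
  grind

theorem pow_three_injective {R : Type*} [CommRing R] [IsDomain R] (h : (3 : R) = 0) {x y : R}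
    (hxy : x ^ 3 = y ^ 3) : x = y := by
  have : (x - y) ^ 3 = 0 := by linear_combination hxy - x * y * (x - y) * h
  exact sub_eq_zero.1 (pow_eq_zero_iff three_ne_zero |>.1 this)

omit [CharP k 3] in
theorem eq_zero_of_sum_C_mul_X_pow_eq_zero {e₀ e₁ e₂ e₃ e₄ e₅ e₆ e₇ : k}
    (h : C e₇ * X ^ 7 + C e₆ * X ^ 6 + C e₅ * X ^ 5 + C e₄ * X ^ 4 + C e₃ * X ^ 3 + C e₂ * X ^ 2 +
      C e₁ * X + C e₀ = 0) :
    e₇ = 0 ∧ e₆ = 0 ∧ e₅ = 0 ∧ e₄ = 0 ∧ e₃ = 0 ∧ e₂ = 0 ∧ e₁ = 0 ∧ e₀ = 0 := by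
  have cf (n : ℕ) := congrArg (fun f => f.coeff n) h
  simp only [coeff_add, coeff_C_mul, coeff_X_pow, coeff_X, coeff_C, coeff_zero] at cf
  exact ⟨by simpa using cf 7, by simpa using cf 6, by simpa using cf 5, by simpa using cf 4,
    by simpa using cf 3, by simpa using cf 2, by simpa using cf 1, by simpa using cf 0⟩

/-- Solving the equation satisfied by the coordinates `A`, `B`. -/
theorem coordinates_of_equation [IsAlgClosed k] {x₂ x₁ x₀ y₃ y₂ y₁ y₀ c l : k} (hl : l ≠ 0)
    {A B : k[X]} (hA : A = X ^ 4 + C x₂ * X ^ 2 + C x₁ * X + C x₀)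
    (hB : B = C y₃ * X ^ 3 + C y₂ * X ^ 2 + C y₁ * X + C y₀)
    (h : C l * ((A ^ 3 + C c * B ^ 3) * derivative (derivative (A ^ 2 * B)) -
      C l * B ^ 3 * derivative (derivative (A * B ^ 2))) = -1) :
    y₂ ≠ 0 ∧ y₃ = 0 ∧ y₁ = 0 ∧ x₁ = 0 ∧ y₀ = x₂ * y₂ ∧ c * y₂ ^ 3 = x₂ ^ 3 - x₀ * x₂ ∧
      l * y₂ ^ 4 = x₀ ^ 2 - x₂ ^ 2 * x₀ := by
  have root (x : k) : ∃ z, z ^ 3 = x := IsAlgClosed.exists_pow_nat_eq x (by norm_num)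
  obtain ⟨γ, rfl⟩ := root c
  obtain ⟨κ, hκ⟩ := root l⁻¹
  obtain ⟨δ, rfl⟩ := root l
  have hδ : δ ≠ 0 := by rintro rfl; simp at hl
  have hκδ : (δ * κ) ^ 3 = 1 := by rw [mul_pow, hκ, mul_inv_cancel₀ hl]
  have hκδ' : C δ ^ 3 * C κ ^ 3 = 1 := by rw [← mul_pow, ← C_mul, ← C_pow, hκδ, C_1]
  rw [hA, hB, derivative_derivative_sq_mul, derivative_derivative_mul_sq, ← hA, ← hB] at h
  obtain ⟨p₃, hp₃⟩ := root y₃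
  obtain ⟨p₂, hp₂⟩ := root (y₀ + 2 * x₂ * y₂ + 2 * x₁ * y₃)
  obtain ⟨p₁, hp₁⟩ := root ((2 * x₀ + x₂ ^ 2) * y₁ + 2 * x₁ * y₀ + 2 * x₁ * x₂ * y₂ +
          (2 * x₀ * x₂ + x₁ ^ 2) * y₃)
  obtain ⟨p₀, hp₀⟩ := root (y₂ * x₀ ^ 2 + 2 * x₁ * x₀ * y₁ + (2 * x₂ * x₀ + x₁ ^ 2) * y₀)
  obtain ⟨q₂, hq₂⟩ := root (y₂ ^ 2 + 2 * y₁ * y₃ + x₂ * y₃ ^ 2)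
  obtain ⟨q₁, hq₁⟩ := root (2 * y₀ * y₁ + x₂ * (2 * y₃ * y₀ + 2 * y₂ * y₁) +
    x₁ * (2 * y₃ * y₁ + y₂ ^ 2) + 2 * x₀ * y₃ * y₂)
  obtain ⟨q₀, hq₀⟩ := root (x₀ * (2 * y₀ * y₂ + y₁ ^ 2) + 2 * x₁ * y₀ * y₁ + x₂ * y₀ ^ 2)
  rw [← hp₂, ← hp₁, ← hp₀, ← hq₂, ← hq₁, ← hq₀] at h
  have hp₃' : C y₃ = C p₃ ^ 3 := by rw [← C_pow, hp₃]
  rw [hp₃'] at h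
  simp only [C_pow] at h
  -- The whole equation is an identity of cubes; this is its cube root, of degree at most 7.
  have E : (A + C γ * B) * (C p₃ * X ^ 3 + C p₂ * X ^ 2 + C p₁ * X + C p₀) -
      C δ * B * (C q₂ * X ^ 2 + C q₁ * X + C q₀) = C κ := by
    apply pow_three_injective (three_eq_zero_poly (k := k))
    have hC : (C δ : k[X]) ^ 3 ≠ 0 := pow_ne_zero 3 (by simpa using hδ)
    apply mul_left_cancel₀ hC
    rw [hκδ']
    clear hA hB
    generalize (X : k[X]) = X at *
    generalize C δ = δ at *
    generalize C γ = γ at *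
    generalize C p₃ = p₃ at *
    generalize C p₂ = p₂ at *
    generalize C p₁ = p₁ at *
    generalize C p₀ = p₀ at *
    generalize C q₂ = q₂ at *
    generalize C q₁ = q₁ at *
    generalize C q₀ = q₀ at *
    clear * - h
    have cube_add (x y : k[X]) : (x + y) ^ 3 = x ^ 3 + y ^ 3 := by grind
    have cube_sub (x y : k[X]) : (x - y) ^ 3 = x ^ 3 - y ^ 3 := by grind
    simp only [mul_pow, cube_sub, cube_add]
    linear_combination -h
  obtain ⟨t₇, t₆, t₅, t₄, t₃, t₂, t₁, t₀⟩ := eq_zero_of_sum_C_mul_X_pow_eq_zero (k := k)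
    (e₇ := p₃) (e₆ := p₂ + γ * y₃ * p₃)
    (e₅ := p₁ + x₂ * p₃ + γ * (y₃ * p₂ + y₂ * p₃) - δ * y₃ * q₂)
    (e₄ := p₀ + x₂ * p₂ + x₁ * p₃ + γ * (y₃ * p₁ + y₂ * p₂ + y₁ * p₃) - δ * (y₃ * q₁ + y₂ * q₂))
    (e₃ := x₂ * p₁ + x₁ * p₂ + x₀ * p₃ + γ * (y₃ * p₀ + y₂ * p₁ + y₁ * p₂ + y₀ * p₃) -
      δ * (y₃ * q₀ + y₂ * q₁ + y₁ * q₂))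
    (e₂ := x₂ * p₀ + x₁ * p₁ + x₀ * p₂ + γ * (y₂ * p₀ + y₁ * p₁ + y₀ * p₂) -
      δ * (y₂ * q₀ + y₁ * q₁ + y₀ * q₂))
    (e₁ := x₁ * p₀ + x₀ * p₁ + γ * (y₁ * p₀ + y₀ * p₁) - δ * (y₁ * q₀ + y₀ * q₁))
    (e₀ := x₀ * p₀ + γ * y₀ * p₀ - δ * y₀ * q₀ - κ) (by
      rw [hA, hB] at E
      simp only [C_add, C_sub, C_mul]
      linear_combination E)
  obtain rfl : p₃ = 0 := t₇
  obtain rfl : y₃ = 0 := by rw [← hp₃]; simp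
  obtain rfl : p₂ = 0 := by linear_combination t₆
  obtain rfl : p₁ = 0 := by linear_combination t₅
  simp only [mul_zero, zero_mul, add_zero, zero_add] at *
  clear h hA hB E hp₃' hκδ'
  have hq : q₂ = 0 → y₂ = 0 := by
    rintro rfl
    simpa using hq₂.symm
  -- Otherwise `p₀`, then `y₀`, then `κ` vanish, against `(δκ)³ = 1`.
  have hy : y₂ ≠ 0 := by
    rintro rfl
    have hp : p₀ = 0 := by linear_combination t₄
    subst hp
    have hy₀ : y₀ = 0 := by linear_combination -hp₂
    subst hy₀
    have : κ = 0 := by linear_combination -t₀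
    simp [this] at hκδ
  have hq₂0 : q₂ ≠ 0 := mt hq hy
  obtain rfl : p₀ = δ * y₂ * q₂ := by linear_combination t₄
  have hy₀ : y₀ = x₂ * y₂ := by linear_combination -hp₂ - x₂ * y₂ * three_eq_zero (k := k)
  subst hy₀
  have u₃ : y₂ * q₁ = -(y₁ * q₂) := mul_left_cancel₀ hδ (by linear_combination -t₃)
  -- `s` is the cube of `u₃`, and `r` eliminates `γ`, `q₀` and `q₁` from `t₁, t₂`. Together they
  -- give `2y₁³ = 0`.
  have s : y₂ * (x₂ * y₁ * y₂ + x₁ * y₂ ^ 2) = -y₁ ^ 3 := by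
    apply mul_left_cancel₀ (pow_ne_zero 2 hy)
    have : (y₂ * q₁) ^ 3 = (-(y₁ * q₂)) ^ 3 := by rw [u₃]
    linear_combination this - y₂ ^ 3 * hq₁ - y₁ ^ 3 * hq₂ - y₂ ^ 4 * x₂ * y₁ * three_eq_zero (k := k)
  have r : δ * q₂ * (y₂ ^ 2 * (x₂ * y₁ - x₁ * y₂) + y₁ ^ 3 - 2 * x₂ * y₂ ^ 2 * y₁) = 0 := by
    linear_combination y₂ * y₁ * t₂ - y₂ ^ 2 * t₁ + δ * (y₁ ^ 2 - y₂ ^ 2 * x₂) * u₃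
  have hy₁ : y₁ = 0 := by
    have r' := (mul_eq_zero.1 r).resolve_left (mul_ne_zero hδ hq₂0)
    have : y₁ ^ 3 = 0 := by linear_combination y₁ ^ 3 * three_eq_zero (k := k) - r' - s
    exact pow_eq_zero_iff three_ne_zero |>.1 this
  subst hy₁
  have hx₁ : x₁ = 0 := by
    have : y₂ ^ 3 * x₁ = 0 := by linear_combination s
    exact (mul_eq_zero.1 this).resolve_left (pow_ne_zero 3 hy)
  subst hx₁
  have hq₁0 : q₁ = 0 := by
    have : y₂ * q₁ = 0 := by linear_combination u₃
    exact (mul_eq_zero.1 this).resolve_left hy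
  subst hq₁0
  have u₂ : γ * y₂ * q₂ = q₀ := by
    apply mul_left_cancel₀ (mul_ne_zero hδ hy)
    linear_combination t₂
  -- Cubing returns from the auxiliary cube roots to the original coefficients: `v₂` yields the
  -- relation for `c`, and `hp₀` the one for `l`.
  have v₂ := congrArg (· ^ 3) u₂
  simp only [mul_pow, hq₂, hq₀] at v₂
  simp only [mul_pow, hq₂] at hp₀
  refine ⟨hy, trivial, rfl, rfl, rfl, mul_left_cancel₀ (pow_ne_zero 2 hy) ?_, mul_left_cancel₀ hy ?_⟩
  · linear_combination v₂ + x₀ * x₂ * y₂ ^ 2 * three_eq_zero (k := k)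
  · linear_combination hp₀ + x₀ * x₂ ^ 2 * y₂ * three_eq_zero (k := k)

end Solve

/-! ### Normal forms of quartic pairs. -/

section NormalForm

theorem eq_of_natDegree_le_four {R : Type*} [CommRing R] {Q : R[X]} (h : Q.natDegree ≤ 4) :
    Q = C (Q.coeff 4) * X ^ 4 + C (Q.coeff 3) * X ^ 3 + C (Q.coeff 2) * X ^ 2 +
      C (Q.coeff 1) * X + C (Q.coeff 0) := by
  conv_lhs => rw [Q.as_sum_range_C_mul_X_pow' (Nat.lt_succ_of_le h)]
  simp only [Finset.sum_range_succ, Finset.sum_range_zero]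
  ring

variable {k : Type*} [Field k]

/-- The coefficients of `X⁴` of the nontrivial combinations of a quartic pair do not vanish. -/
theorem IsQuarticPair.coeff_four_ne_zero {Q₁ Q₂ : k[X]} (h : IsQuarticPair Q₁ Q₂) :
    Q₁.coeff 4 ≠ 0 ∧ Q₂.coeff 4 ≠ 0 ∧ Q₁.coeff 4 + Q₂.coeff 4 ≠ 0 ∧
      Q₁.coeff 4 - Q₂.coeff 4 ≠ 0 := by
  rw [← coeff_add, ← coeff_sub]
  exact ⟨coeff_ne_zero_of_eq_degree h.left, coeff_ne_zero_of_eq_degree h.right,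
    coeff_ne_zero_of_eq_degree h.add, coeff_ne_zero_of_eq_degree h.sub⟩

theorem sq_notMem_primeField {a : k} (h₀ : a ≠ 0) (h₁ : a ^ 2 ≠ 1) (h₂ : a ^ 2 + 1 ≠ 0)
    [Algebra (ZMod 3) k] : a ^ 2 ∉ Set.range (algebraMap (ZMod 3) k) := by
  rintro ⟨i, hi⟩
  rcases zmod_three_cases i with rfl | rfl | rfl
  · rw [map_zero] at hi
    exact pow_ne_zero 2 h₀ hi.symm
  · rw [map_one] at hi
    exact h₁ hi.symm
  · rw [map_neg, map_one] at hi
    exact h₂ (by rw [← hi]; ring)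

theorem ne_of_sq_notMem_primeField {a : k} [Algebra (ZMod 3) k]
    (h : a ^ 2 ∉ Set.range (algebraMap (ZMod 3) k)) : a ≠ 0 ∧ a ^ 2 ≠ 1 ∧ a ^ 2 + 1 ≠ 0 := by
  refine ⟨?_, ?_, ?_⟩
  · rintro rfl
    exact h ⟨0, by simp⟩
  · intro e
    exact h ⟨1, by simp [e]⟩
  · intro e
    exact h ⟨-1, by rw [map_neg, map_one]; linear_combination -e⟩

variable [CharP k 3]

theorem exists_normal_form [IsAlgClosed k] {Q₁ Q₂ : k[X]} (h : IsQuarticPair Q₁ Q₂)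
    (hw : wronskianSum Q₁ Q₂ = -1) :
    ∃ α β x y z s : k, α ≠ 0 ∧ α + β ≠ 0 ∧ α - β ≠ 0 ∧ β ≠ 0 ∧ y ≠ 0 ∧
      (α ^ 2 + β ^ 2) * (α ^ 4 + β ^ 4) * y ^ 3 = x ^ 3 - z * x ∧
      (α * β ^ 3 - α ^ 3 * β) ^ 2 * y ^ 4 = z ^ 2 - x ^ 2 * z ∧
      Q₁.comp (X + C s) = C α * (X ^ 4 + C x * X ^ 2 + C z) + C (α ^ 3 * y) * (X ^ 2 + C x) ∧
      Q₂.comp (X + C s) = C β * (X ^ 4 + C x * X ^ 2 + C z) + C (β ^ 3 * y) * (X ^ 2 + C x) := by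
  obtain ⟨h₁, h₂, h₃, h₄⟩ := h.coeff_four_ne_zero
  obtain ⟨α, hα⟩ : ∃ α, Q₁.coeff 4 = α := ⟨_, rfl⟩
  obtain ⟨β, hβ⟩ : ∃ β, Q₂.coeff 4 = β := ⟨_, rfl⟩
  rw [hα] at h₁ h₃ h₄
  rw [hβ] at h₂ h₃ h₄
  set L := α * β ^ 3 - α ^ 3 * β with hL
  -- `L` is the determinant of the system expressing `Q₁, Q₂` in `A, B`; it is, up to sign, the
  -- product of the leading coefficients of `Q₁, Q₂, Q₁ ± Q₂`.
  have hL0 : L ≠ 0 := by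
    have : L = -(α * β * (α + β) * (α - β)) := by rw [hL]; ring
    rw [this]
    exact neg_ne_zero.2 (mul_ne_zero (mul_ne_zero (mul_ne_zero h₁ h₂) h₃) h₄)
  obtain ⟨A, hA⟩ : ∃ A, A = C (β ^ 3 / L) * Q₁ - C (α ^ 3 / L) * Q₂ := ⟨_, rfl⟩
  obtain ⟨B, hB⟩ : ∃ B, B = C (α / L) * Q₂ - C (β / L) * Q₁ := ⟨_, rfl⟩
  have hQ₁ : Q₁ = C α * A + C (α ^ 3) * B := by
    have e₁ : α * (β ^ 3 / L) - α ^ 3 * (β / L) = 1 := by field_simp; rw [hL]; ring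
    have e₁' := congrArg (C : k → k[X]) e₁
    simp only [C_sub, C_mul, C_1, C_pow] at e₁'
    have e₂ := congrArg (C : k → k[X]) (show α * (α ^ 3 / L) = α ^ 3 * (α / L) by ring)
    simp only [C_mul] at e₂
    rw [hA, hB, C_pow]
    simp only [C_pow] at e₂
    linear_combination -Q₁ * e₁' + Q₂ * e₂
  have hQ₂ : Q₂ = C β * A + C (β ^ 3) * B := by
    have e₁ : β ^ 3 * (α / L) - β * (α ^ 3 / L) = 1 := by field_simp; rw [hL]; ring
    have e₁' := congrArg (C : k → k[X]) e₁
    simp only [C_sub, C_mul, C_1, C_pow] at e₁'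
    have e₂ := congrArg (C : k → k[X]) (show β * (β ^ 3 / L) = β ^ 3 * (β / L) by ring)
    simp only [C_mul] at e₂
    rw [hA, hB, C_pow]
    simp only [C_pow] at e₂
    linear_combination -Q₂ * e₁' - Q₁ * e₂
  have dQ₁ := natDegree_of_degree_eq_four h.left
  have dQ₂ := natDegree_of_degree_eq_four h.right
  have dA : A.natDegree ≤ 4 := hA ▸ (natDegree_sub_le_of_le
    ((natDegree_C_mul_le _ _).trans dQ₁.le) ((natDegree_C_mul_le _ _).trans dQ₂.le))
  have dB : B.natDegree ≤ 4 := hB ▸ (natDegree_sub_le_of_le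
    ((natDegree_C_mul_le _ _).trans dQ₂.le) ((natDegree_C_mul_le _ _).trans dQ₁.le))
  have cA : A.coeff 4 = 1 := by
    rw [hA, coeff_sub, coeff_C_mul, coeff_C_mul, hα, hβ]
    field_simp
    rw [hL]
    ring
  have cB : B.coeff 4 = 0 := by
    rw [hB, coeff_sub, coeff_C_mul, coeff_C_mul, hα, hβ]
    ring
  have eA := eq_of_natDegree_le_four dA
  have eB := eq_of_natDegree_le_four dB
  rw [cA] at eA
  rw [cB] at eB
  set t := A.coeff 3
  set a₂ := A.coeff 2
  set a₁ := A.coeff 1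
  set a₀ := A.coeff 0
  set b₃ := B.coeff 3
  set b₂ := B.coeff 2
  set b₁ := B.coeff 1
  set b₀ := B.coeff 0
  have h3 := three_eq_zero_poly (k := k)
  -- The usual translation by `t/4` removing the cubic term; here `4 = 1`.
  have fA : A.comp (C 1 * X + C (-t)) = X ^ 4 + C a₂ * X ^ 2 +
      C (-t ^ 3 - 2 * a₂ * t + a₁) * X + C (a₂ * t ^ 2 - a₁ * t + a₀) := by
    rw [eA]
    simp only [add_comp, mul_comp, pow_comp, X_comp, C_comp, C_1, C_neg, C_sub, C_add, C_mul,
      C_pow, C_ofNat, one_comp]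
    clear * - h3
    grind
  have fB : B.comp (C 1 * X + C (-t)) = C b₃ * X ^ 3 + C b₂ * X ^ 2 +
      C (-2 * b₂ * t + b₁) * X + C (-b₃ * t ^ 3 + b₂ * t ^ 2 - b₁ * t + b₀) := by
    rw [eB]
    simp only [add_comp, mul_comp, pow_comp, X_comp, C_comp, C_1, C_neg, C_sub, C_add, C_mul,
      C_pow, C_ofNat, C_0, zero_comp]
    clear * - h3
    grind
  have hw' := wronskianSum_comp 1 (-t) Q₁ Q₂
  have gQ₁ : Q₁.comp (C 1 * X + C (-t)) =
      C α * A.comp (C 1 * X + C (-t)) + C (α ^ 3) * B.comp (C 1 * X + C (-t)) := by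
    conv_lhs => rw [hQ₁]
    simp
  have gQ₂ : Q₂.comp (C 1 * X + C (-t)) =
      C β * A.comp (C 1 * X + C (-t)) + C (β ^ 3) * B.comp (C 1 * X + C (-t)) := by
    conv_lhs => rw [hQ₂]
    simp
  rw [gQ₁, gQ₂, wronskianSum_eq, hw] at hw'
  obtain ⟨r₁, r₂, r₃, r₄, r₅, r₆, r₇⟩ :=
    coordinates_of_equation (pow_ne_zero 2 hL0) fA fB (by rw [hw']; simp)
  rw [r₅, r₃, r₂] at fB
  rw [r₄] at fA
  rw [fA, fB] at gQ₁ gQ₂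
  refine ⟨α, β, a₂, b₂, _, -t, h₁, h₃, h₄, h₂, r₁, r₆, r₇, ?_, ?_⟩
  · rw [C_1, one_mul] at gQ₁
    rw [gQ₁]
    simp only [C_mul, C_0]
    ring
  · rw [C_1, one_mul] at gQ₂
    rw [gQ₂]
    simp only [C_mul, C_0]
    ring

/-- The normal form with a suitable sum of squares of the leading coefficients is an affine
transform of `Qone a`, `Qtwo a`. -/
theorem exists_affine_of_normal_form [IsAlgClosed k] {α β x y z v : k} (hα : α ≠ 0) (hy : y ≠ 0)
    (hs : α ^ 2 + β ^ 2 ≠ 0) (hv : v = (α ^ 2 + β ^ 2) ^ 2)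
    (hx : x * v = (α ^ 2 + β ^ 2) * (α ^ 4 + β ^ 4) * y) (hz : z = x ^ 2 - y ^ 2 * v) :
    ∃ e r : k, e ≠ 0 ∧ r ≠ 0 ∧
      C α * (X ^ 4 + C x * X ^ 2 + C z) + C (α ^ 3 * y) * (X ^ 2 + C x) =
        C e * (Qone (β / α)).comp (C r * X) ∧
      C β * (X ^ 4 + C x * X ^ 2 + C z) + C (β ^ 3 * y) * (X ^ 2 + C x) =
        C e * (Qtwo (β / α)).comp (C r * X) := by
  obtain ⟨a, rfl⟩ : ∃ a, β = α * a := ⟨β / α, by field_simp⟩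
  have ha : 1 + a ^ 2 ≠ 0 := by
    rintro h
    apply hs
    linear_combination α ^ 2 * h
  have hm : α ^ 2 * y ≠ 0 := mul_ne_zero (pow_ne_zero 2 hα) hy
  -- The homothety is chosen to bring `y` to `-(1 + a²)` after normalizing `α` to 1; `hx` and `hz`
  -- then determine `x` and `z`.
  obtain ⟨r, hr⟩ := IsAlgClosed.exists_pow_nat_eq (-(1 + a ^ 2) / (α ^ 2 * y)) (n := 2) (by norm_num)
  have hr0 : r ≠ 0 := by
    rintro rfl
    rw [zero_pow two_ne_zero, eq_comm, div_eq_zero_iff, neg_eq_zero] at hr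
    exact hr.elim ha hm
  have hy' : y * (α ^ 2 * r ^ 2) = -(1 + a ^ 2) := by
    rw [hr]
    field_simp
  have hxr : x * r ^ 2 = -(1 + a ^ 4) := by
    apply mul_right_cancel₀ (pow_ne_zero 2 ha)
    apply mul_left_cancel₀ (pow_ne_zero 4 hα)
    rw [hv] at hx
    linear_combination r ^ 2 * hx + α ^ 4 * (1 + a ^ 2) * (1 + a ^ 4) * hy'
  have hzr : z * r ^ 4 = (1 + a ^ 4) ^ 2 - (1 + a ^ 2) ^ 4 := by
    rw [hz, hv]
    linear_combination (x * r ^ 2 - (1 + a ^ 4)) * hxr -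
      (1 + a ^ 2) ^ 2 * (y * (α ^ 2 * r ^ 2) - (1 + a ^ 2)) * hy'
  have hr4 : r ^ 4 ≠ 0 := pow_ne_zero 4 hr0
  have h3 := three_eq_zero (k := k)
  obtain ⟨e, he⟩ : ∃ e, e = α / r ^ 4 := ⟨_, rfl⟩
  have k₄ : e * r ^ 4 = α := by
    rw [he]
    field_simp
  have k₂ : α * x + α ^ 3 * y = -e * (a ^ 4 + a ^ 2 - 1) * r ^ 2 := by
    apply mul_right_cancel₀ (pow_ne_zero 2 hr0)
    linear_combination α * hxr + α * hy' + (a ^ 4 + a ^ 2 - 1) * k₄ - α * h3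
  have k₀ : α * z + α ^ 3 * y * x = e := by
    apply mul_right_cancel₀ hr4
    linear_combination α * hzr + α * (y * (α ^ 2 * r ^ 2)) * hxr - α * (1 + a ^ 4) * hy' - k₄ -
      α * (a ^ 2 + a ^ 4 + a ^ 6) * h3
  have l₂ : α * a * x + (α * a) ^ 3 * y = e * a * (a ^ 4 - a ^ 2 - 1) * r ^ 2 := by
    apply mul_right_cancel₀ (pow_ne_zero 2 hr0)
    linear_combination α * a * hxr + α * a ^ 3 * hy' - a * (a ^ 4 - a ^ 2 - 1) * k₄ -
      α * a ^ 5 * h3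
  have l₀ : α * a * z + (α * a) ^ 3 * y * x = e * a * a ^ 8 := by
    apply mul_right_cancel₀ hr4
    linear_combination α * a * hzr + α * a ^ 3 * (y * (α ^ 2 * r ^ 2)) * hxr -
      α * a ^ 3 * (1 + a ^ 4) * hy' - a ^ 9 * k₄ - α * a * (a ^ 2 + a ^ 4 + a ^ 6) * h3
  refine ⟨e, r, he ▸ div_ne_zero hα hr4, hr0, ?_, ?_⟩
  · rw [mul_div_cancel_left₀ _ hα, Qone]
    replace k₂ := congrArg (C : k → k[X]) k₂
    replace k₀ := congrArg (C : k → k[X]) k₀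
    replace k₄ := congrArg (C : k → k[X]) k₄
    simp only [add_comp, sub_comp, mul_comp, pow_comp, X_comp, C_comp, one_comp, C_1, C_neg, C_sub,
      C_add, C_mul, C_pow] at *
    linear_combination k₂ * X ^ 2 + k₀ - X ^ 4 * k₄
  · rw [mul_div_cancel_left₀ _ hα, Qtwo]
    replace l₂ := congrArg (C : k → k[X]) l₂
    replace l₀ := congrArg (C : k → k[X]) l₀
    replace k₄ := congrArg (C : k → k[X]) k₄
    simp only [add_comp, sub_comp, mul_comp, pow_comp, X_comp, C_comp, one_comp, C_1, C_sub,
      C_add, C_mul, C_pow] at *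
    linear_combination l₂ * X ^ 2 + l₀ - X ^ 4 * C a * k₄

/-- Converse to `coordinates_of_equation`: `(A²B)''` reduces to a constant and the nonconstant terms
cancel, so the two relations suffice up to a scalar. -/
theorem wronskianSum_of_normal_form {α β x y z : k}
    (hc : (α ^ 2 + β ^ 2) * (α ^ 4 + β ^ 4) * y ^ 3 = x ^ 3 - z * x)
    (hl : (α * β ^ 3 - α ^ 3 * β) ^ 2 * y ^ 4 = z ^ 2 - x ^ 2 * z) :
    wronskianSum (C α * (X ^ 4 + C x * X ^ 2 + C z) + C (α ^ 3 * y) * (X ^ 2 + C x))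
        (C β * (X ^ 4 + C x * X ^ 2 + C z) + C (β ^ 3 * y) * (X ^ 2 + C x)) =
      -C ((α * β ^ 3 - α ^ 3 * β) ^ 4 * y ^ 5 * z ^ 3) := by
  have e (u v : k) : C u * (X ^ 4 + C x * X ^ 2 + C z) + C (v * y) * (X ^ 2 + C x) =
      C u * (X ^ 4 + C x * X ^ 2 + C 0 * X + C z) +
        C v * (C 0 * X ^ 3 + C y * X ^ 2 + C 0 * X + C (x * y)) := by
    simp only [C_mul, C_0]
    ring
  rw [e, e, wronskianSum_eq, derivative_derivative_sq_mul, derivative_derivative_mul_sq]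
  generalize α * β ^ 3 - α ^ 3 * β = L at *
  generalize (α ^ 2 + β ^ 2) * (α ^ 4 + β ^ 4) = c at *
  replace hc := congrArg (C : k → k[X]) hc
  replace hl := congrArg (C : k → k[X]) hl
  simp only [C_add, C_sub, C_mul, C_pow, C_ofNat, C_0] at *
  generalize C L = L at *
  generalize C c = c at *
  generalize C x = x at *
  generalize C y = y at *
  generalize C z = z at *
  generalize (X : k[X]) = X at *
  clear e
  grind

end NormalForm

/-! ### Changing the basis over `𝔽₃`, and reduction to the family. -/

section BasisChange

variable {k : Type*} [Field k] [CharP k 3]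

theorem IsQuarticPair.add_left {Q₁ Q₂ : k[X]} (h : IsQuarticPair Q₁ Q₂) :
    IsQuarticPair (Q₁ + Q₂) Q₂ := by
  refine ⟨h.add, h.right, ?_, ?_⟩
  · have e : Q₁ + Q₂ + Q₂ = Q₁ - Q₂ := by linear_combination Q₂ * three_eq_zero_poly (k := k)
    rw [e, h.sub]
  · rw [add_sub_cancel_right, h.left]

/-- Both sides are minus the product of `Q₁ + jQ₂` over `j ∈ 𝔽₃`, whose factors are permuted. -/
theorem mul_sq_sub_cube_add_left (Q₁ Q₂ : k[X]) :
    (Q₁ + Q₂) * Q₂ ^ 2 - (Q₁ + Q₂) ^ 3 = Q₁ * Q₂ ^ 2 - Q₁ ^ 3 := by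
  linear_combination -(Q₁ ^ 2 * Q₂ + Q₁ * Q₂ ^ 2) * three_eq_zero_poly (k := k)

theorem wronskianSum_add_left (Q₁ Q₂ : k[X]) :
    wronskianSum (Q₁ + Q₂) Q₂ = wronskianSum Q₁ Q₂ := by
  rw [← derivative_derivative_sq, mul_sq_sub_cube_add_left, derivative_derivative_sq]

theorem baseForm_add_left (Q₁ Q₂ : k[X]) : baseForm (Q₁ + Q₂) Q₂ = baseForm Q₁ Q₂ := by
  rw [baseForm, mul_sq_sub_cube_add_left, baseForm]

theorem IsQuarticPair.baseForm_add_right {Q₁ Q₂ : k[X]} (h : IsQuarticPair Q₁ Q₂) :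
    baseForm Q₂ (Q₁ + Q₂) = baseForm Q₂ Q₁ - baseForm Q₁ Q₂ := by
  apply (coeff k).injective
  rw [h.symm.coeff_baseForm_sub, coeff_baseForm]
  congr 2
  linear_combination Q₁ * Q₂ ^ 2 * three_eq_zero_poly (k := k)

theorem IsQuarticPair.span_add_left [Algebra (ZMod 3) k] {Q₁ Q₂ : k[X]}
    (h : IsQuarticPair Q₁ Q₂) :
    Submodule.span (ZMod 3) {baseForm (Q₁ + Q₂) Q₂, baseForm Q₂ (Q₁ + Q₂)} =
      Submodule.span (ZMod 3) {baseForm Q₁ Q₂, baseForm Q₂ Q₁} := by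
  rw [baseForm_add_left, h.baseForm_add_right]
  apply le_antisymm <;> rw [Submodule.span_le, Set.insert_subset_iff, Set.singleton_subset_iff] <;>
    refine ⟨Submodule.subset_span (by simp), Submodule.mem_span_pair.2 ?_⟩
  · exact ⟨-1, 1, by rw [neg_smul, one_smul, one_smul]; abel⟩
  · exact ⟨1, 1, by rw [one_smul, one_smul]; abel⟩

/-- Every pair of quartic polynomials with the logarithmic property can be transformed to
`Qone a`, `Qtwo a`. -/
theorem exists_eq_Qone_Qtwo [IsAlgClosed k] [Algebra (ZMod 3) k] {Q₁ Q₂ : k[X]}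
    (h : IsQuarticPair Q₁ Q₂) (hw : wronskianSum Q₁ Q₂ = -1) :
    ∃ (R : k[X]) (a e r s : k), IsQuarticPair R Q₂ ∧ wronskianSum R Q₂ = -1 ∧
      Submodule.span (ZMod 3) {baseForm R Q₂, baseForm Q₂ R} =
        Submodule.span (ZMod 3) {baseForm Q₁ Q₂, baseForm Q₂ Q₁} ∧
      a ^ 2 ∉ Set.range (algebraMap (ZMod 3) k) ∧ e ≠ 0 ∧ r ≠ 0 ∧
      R.comp (C r * X + C s) = C e * Qone a ∧ Q₂.comp (C r * X + C s) = C e * Qtwo a := by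
  obtain ⟨α, β, x, y, z, s, hα, ha, hs, hβ, hy, hc, hl, e₁, e₂⟩ := exists_normal_form h hw
  have h3 := three_eq_zero (k := k)
  have h3p := three_eq_zero_poly (k := k)
  obtain ⟨v, hv⟩ : ∃ v, y ^ 2 * v = x ^ 2 - z :=
    ⟨(x ^ 2 - z) / y ^ 2, mul_div_cancel₀ _ (pow_ne_zero 2 hy)⟩
  have hv0 : v ≠ 0 := by
    rintro rfl
    have : (α * β ^ 3 - α ^ 3 * β) ^ 2 * y ^ 4 = 0 := by linear_combination hl + z * hv
    have hL : α * β ^ 3 - α ^ 3 * β = -(α * β * (α + β) * (α - β)) := by ring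
    rw [hL] at this
    simp [hα, ha, hs, hβ, hy] at this
  have hx : x * v = (α ^ 2 + β ^ 2) * (α ^ 4 + β ^ 4) * y := by
    apply mul_left_cancel₀ (pow_ne_zero 2 hy)
    linear_combination x * hv - hc
  -- Eliminating `x` and `z` gives `v³ - L²v - c² = 0` with `L, c` the Dickson invariants; the three
  -- factors correspond to the replacements of `α` by `α + jβ`.
  have hcub : (v - (α ^ 2 + β ^ 2) ^ 2) * (v - ((α - β) ^ 2 + β ^ 2) ^ 2) *
      (v - ((α + β) ^ 2 + β ^ 2) ^ 2) = 0 := by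
    have e : (v - (α ^ 2 + β ^ 2) ^ 2) * (v - ((α - β) ^ 2 + β ^ 2) ^ 2) *
        (v - ((α + β) ^ 2 + β ^ 2) ^ 2) = v ^ 3 - (α * β ^ 3 - α ^ 3 * β) ^ 2 * v -
          ((α ^ 2 + β ^ 2) * (α ^ 4 + β ^ 4)) ^ 2 := by
      clear * - h3
      grind
    rw [e]
    have hl' : (α * β ^ 3 - α ^ 3 * β) ^ 2 * y ^ 2 = -z * v := by
      apply mul_left_cancel₀ (pow_ne_zero 2 hy)
      linear_combination hl + z * hv
    apply mul_left_cancel₀ (pow_ne_zero 2 hy)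
    linear_combination v ^ 2 * hv - v * hl' +
      (x * v + (α ^ 2 + β ^ 2) * (α ^ 4 + β ^ 4) * y) * hx
  have key (R : k[X]) (α' : k) (hR : IsQuarticPair R Q₂) (hRw : wronskianSum R Q₂ = -1)
      (hsp : Submodule.span (ZMod 3) {baseForm R Q₂, baseForm Q₂ R} =
        Submodule.span (ZMod 3) {baseForm Q₁ Q₂, baseForm Q₂ Q₁}) (hα' : α' ≠ 0)
      (ha' : α' + β ≠ 0) (hs' : α' - β ≠ 0) (hv' : v = (α' ^ 2 + β ^ 2) ^ 2)
      (hc' : (α' ^ 2 + β ^ 2) * (α' ^ 4 + β ^ 4) = (α ^ 2 + β ^ 2) * (α ^ 4 + β ^ 4))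
      (hRe : R.comp (X + C s) =
        C α' * (X ^ 4 + C x * X ^ 2 + C z) + C (α' ^ 3 * y) * (X ^ 2 + C x)) :
      ∃ (R : k[X]) (a e r s : k), IsQuarticPair R Q₂ ∧ wronskianSum R Q₂ = -1 ∧
        Submodule.span (ZMod 3) {baseForm R Q₂, baseForm Q₂ R} =
          Submodule.span (ZMod 3) {baseForm Q₁ Q₂, baseForm Q₂ Q₁} ∧
        a ^ 2 ∉ Set.range (algebraMap (ZMod 3) k) ∧ e ≠ 0 ∧ r ≠ 0 ∧
        R.comp (C r * X + C s) = C e * Qone a ∧ Q₂.comp (C r * X + C s) = C e * Qtwo a := by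
    have hsq : α' ^ 2 + β ^ 2 ≠ 0 := by
      intro h
      rw [h, zero_pow two_ne_zero] at hv'
      exact hv0 hv'
    obtain ⟨e, r, he, hr, f₁, f₂⟩ := exists_affine_of_normal_form hα' hy hsq hv'
      (by rw [hx, hc']) (z := z) (by linear_combination hv)
    have comp_eq (Q T : k[X]) (hQ : Q.comp (X + C s) = C e * T.comp (C r * X)) :
        Q.comp (C r⁻¹ * X + C s) = C e * T := by
      have := congrArg (fun f => f.comp (C r⁻¹ * X)) hQ
      simp only [comp_assoc, mul_comp, C_comp, add_comp, X_comp, ← mul_assoc, ← C_mul,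
        mul_inv_cancel₀ hr, C_1, one_mul, comp_X] at this
      exact this
    refine ⟨R, β / α', e, r⁻¹, s, hR, hRw, hsp, sq_notMem_primeField (div_ne_zero hβ hα') ?_ ?_,
      he, inv_ne_zero hr, comp_eq _ _ (hRe.trans f₁), comp_eq _ _ (e₂.trans f₂)⟩
    · rw [div_pow, Ne, div_eq_one_iff_eq (pow_ne_zero 2 hα'), ← sub_eq_zero]
      intro h
      exact mul_ne_zero ha' hs' (by linear_combination -h)
    · intro h
      apply hsq
      field_simp at h
      linear_combination h
  have e₃ : (Q₁ + Q₂).comp (X + C s) = C (α + β) * (X ^ 4 + C x * X ^ 2 + C z) +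
      C ((α + β) ^ 3 * y) * (X ^ 2 + C x) := by
    rw [add_comp, e₁, e₂]
    simp only [C_add, C_mul, C_pow]
    clear * - h3p
    grind
  rcases mul_eq_zero.1 hcub with hcub | hcub
  · rcases mul_eq_zero.1 hcub with hcub | hcub
    · exact key Q₁ α h hw rfl hα ha hs (sub_eq_zero.1 hcub) rfl e₁
    -- `Q₁ + Q₂ + Q₂` is `Q₁ - Q₂`, written so that `add_left` applies twice.
    · refine key (Q₁ + Q₂ + Q₂) (α - β) h.add_left.add_left ?_ ?_ hs (by simpa using hα) ?_
        (sub_eq_zero.1 hcub) ?_ ?_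
      · rw [wronskianSum_add_left, wronskianSum_add_left, hw]
      · rw [h.add_left.span_add_left, h.span_add_left]
      · intro h
        exact ha (by linear_combination h + β * h3)
      · clear * - h3
        grind
      · rw [add_comp, e₃, e₂]
        simp only [C_add, C_sub, C_mul, C_pow]
        clear * - h3p
        grind
  · refine key (Q₁ + Q₂) (α + β) h.add_left ?_ ?_ ha ?_ (by simpa using hα)
      (sub_eq_zero.1 hcub) ?_ e₃
    · rw [wronskianSum_add_left, hw]
    · rw [h.span_add_left]
    · intro h
      exact hs (by linear_combination h - β * h3)
    · clear * - h3
      grind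

end BasisChange

/-! ### Affine substitutions and pullbacks. -/

section Equivalence

variable {k : Type*} [Field k]

theorem exists_affine_algEquiv {r : k} (hr : r ≠ 0) (s : k) :
    ∃ σ : RatFunc k ≃ₐ[k] RatFunc k, FixesInfty σ ∧ ∀ P : k[X],
      σ (algebraMap k[X] (RatFunc k) P) = algebraMap k[X] (RatFunc k) (P.comp (C r * X + C s)) := by
  let := invertibleOfNonzero hr
  let σ : RatFunc k ≃ₐ[k] RatFunc k :=
    IsFractionRing.algEquivOfAlgEquiv (algEquivCMulXAddC r s)
  have hσ (P : k[X]) : σ (algebraMap k[X] (RatFunc k) P) =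
      algebraMap k[X] (RatFunc k) (P.comp (C r * X + C s)) := by
    rw [IsFractionRing.algEquivOfAlgEquiv_algebraMap, algEquivCMulXAddC_apply]
    rfl
  refine ⟨σ, fun f => ?_, hσ⟩
  by_cases hf : f = 0
  · rw [hf, map_zero]
  have hn : f.num ≠ 0 := RatFunc.num_ne_zero hf
  have hd : f.denom ≠ 0 := f.denom_ne_zero
  have hi {P : k[X]} (hP : P ≠ 0) : algebraMap k[X] (RatFunc k) P ≠ 0 :=
    RatFunc.algebraMap_ne_zero hP
  have hi' {P : k[X]} (hP : P ≠ 0) :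
      algebraMap k[X] (RatFunc k) (P.comp (C r * X + C s)) ≠ 0 := by
    rw [← hσ]
    exact (map_ne_zero σ).2 (hi hP)
  rw [← f.num_div_denom, map_div₀, hσ, hσ, RatFunc.intDegree_div (hi' hn) (hi' hd),
    RatFunc.intDegree_div (hi hn) (hi hd)]
  simp only [RatFunc.intDegree_polynomial, natDegree_comp, natDegree_linear hr, mul_one]

theorem pullback_add (σ : RatFunc k ≃ₐ[k] RatFunc k) (ω ω' : Form k) :
    pullback σ (ω + ω') = pullback σ ω + pullback σ ω' := by
  rw [pullback, pullback, pullback, map_add, map_add, add_smul]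

theorem image_pullback_span_pair [Algebra (ZMod 3) k] (σ : RatFunc k ≃ₐ[k] RatFunc k)
    (ω ω' : Form k) :
    pullback σ '' (Submodule.span (ZMod 3) {ω, ω'} : Set (Form k)) =
      (Submodule.span (ZMod 3) {pullback σ ω, pullback σ ω'} : Set (Form k)) := by
  let f : Form k →ₗ[ZMod 3] Form k :=
    (AddMonoidHom.mk' (pullback σ) (pullback_add σ)).toZModLinearMap 3
  have := Submodule.map_span f {ω, ω'}
  rw [Set.image_pair] at this
  exact (Submodule.map_coe f _).symm.trans (congrArg _ this)

/-- `dX` pulls back to `r dX`, and the form is homogeneous of degree `-3` in the pair; hence the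
cube root of `r⁻¹`. -/
theorem pullback_baseForm {r s c : k} {σ : RatFunc k ≃ₐ[k] RatFunc k}
    (hσ : ∀ P : k[X],
      σ (algebraMap k[X] (RatFunc k) P) = algebraMap k[X] (RatFunc k) (P.comp (C r * X + C s)))
    (hc : c ^ 3 = r⁻¹) (Q₁ Q₂ : k[X]) :
    pullback σ (baseForm Q₁ Q₂) =
      baseForm (C c * Q₁.comp (C r * X + C s)) (C c * Q₂.comp (C r * X + C s)) := by
  have hX : KaehlerDifferential.D k (RatFunc k) (σ RatFunc.X) = r • dX k := by
    apply (coeff k).injective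
    rw [coeff_D, ← RatFunc.algebraMap_X, hσ, ratDeriv_algebraMap, algebraMap_smul_form,
      coeff_smul_dX, X_comp]
    simp only [derivative_add, derivative_mul, derivative_C, derivative_X, zero_mul, zero_add,
      mul_one, add_zero, RatFunc.algebraMap_C]
    rfl
  rw [← inv_pow_three_smul_baseForm, hc, inv_inv, pullback, hX, smul_comm, coeff_baseForm,
    map_inv₀, hσ, baseForm]
  simp only [sub_comp, mul_comp, pow_comp]

end Equivalence

/-! ### The family `Qone a`, `Qtwo a`. -/

section Family

variable {k : Type*} [Field k]

theorem degree_biquadratic {u v w : k} (hu : u ≠ 0) :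
    (C u * X ^ 4 + C v * X ^ 2 + C w : k[X]).degree = 4 := by
  compute_degree!

theorem isQuarticPair_Qone_Qtwo {a : k} (h₀ : a ≠ 0) (h₁ : a ^ 2 ≠ 1) :
    IsQuarticPair (Qone a) (Qtwo a) := by
  have e₁ : Qone a = C 1 * X ^ 4 + C (-(a ^ 4 + a ^ 2 - 1)) * X ^ 2 + C 1 := by
    simp only [Qone, C_1, C_neg]
    ring
  have e₂ : Qtwo a = C a * X ^ 4 + C (a * (a ^ 4 - a ^ 2 - 1)) * X ^ 2 + C (a * a ^ 8) := by
    simp only [Qtwo, C_mul]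
    ring
  have e₃ (u v w u' v' w' : k) : (C u * X ^ 4 + C v * X ^ 2 + C w : k[X]) +
      (C u' * X ^ 4 + C v' * X ^ 2 + C w') =
        C (u + u') * X ^ 4 + C (v + v') * X ^ 2 + C (w + w') := by
    simp only [C_add]
    ring
  have e₄ (u v w u' v' w' : k) : (C u * X ^ 4 + C v * X ^ 2 + C w : k[X]) -
      (C u' * X ^ 4 + C v' * X ^ 2 + C w') =
        C (u - u') * X ^ 4 + C (v - v') * X ^ 2 + C (w - w') := by
    simp only [C_sub]
    ring
  rw [e₁, e₂]
  refine ⟨degree_biquadratic one_ne_zero, degree_biquadratic h₀, ?_, ?_⟩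
  · rw [e₃]
    refine degree_biquadratic fun h => h₁ ?_
    linear_combination (a - 1) * h
  · rw [e₄]
    refine degree_biquadratic fun h => h₁ ?_
    linear_combination -(a + 1) * h

variable [CharP k 3]

theorem wronskianSum_Qone_Qtwo {a : k} (h₀ : a ≠ 0) (h₁ : a ^ 2 ≠ 1) (h₂ : a ^ 2 + 1 ≠ 0) :
    ∃ K : k, K ≠ 0 ∧ wronskianSum (Qone a) (Qtwo a) = -C K := by
  have h3 := three_eq_zero (k := k)
  have h3p := three_eq_zero_poly (k := k)
  -- These are the values of `x, y, z` found in `exists_affine_of_normal_form` when `α = r = 1`.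
  have h := wronskianSum_of_normal_form (α := 1) (β := a) (x := -(a ^ 4 + 1)) (y := -(a ^ 2 + 1))
    (z := -(a ^ 2 + a ^ 4 + a ^ 6)) (by clear * - h3; grind) (by clear * - h3; grind)
  have e₁ : Qone a = C 1 * (X ^ 4 + C (-(a ^ 4 + 1)) * X ^ 2 + C (-(a ^ 2 + a ^ 4 + a ^ 6))) +
      C (1 ^ 3 * -(a ^ 2 + 1)) * (X ^ 2 + C (-(a ^ 4 + 1))) := by
    simp only [Qone, C_1, C_neg, C_add, C_sub, C_mul, C_pow]
    clear * - h3p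
    grind
  have e₂ : Qtwo a = C a * (X ^ 4 + C (-(a ^ 4 + 1)) * X ^ 2 + C (-(a ^ 2 + a ^ 4 + a ^ 6))) +
      C (a ^ 3 * -(a ^ 2 + 1)) * (X ^ 2 + C (-(a ^ 4 + 1))) := by
    simp only [Qtwo, C_1, C_neg, C_add, C_sub, C_mul, C_pow]
    clear * - h3p
    grind
  rw [← e₁, ← e₂] at h
  refine ⟨_, ?_, h⟩
  have h₁' : a ^ 2 - 1 ≠ 0 := sub_ne_zero.2 h₁
  have f₁ : 1 * a ^ 3 - 1 ^ 3 * a = a * (a ^ 2 - 1) := by ring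
  have f₂ : -(a ^ 2 + a ^ 4 + a ^ 6) = -(a ^ 2 * (a ^ 2 - 1) ^ 2) := by
    linear_combination -a ^ 4 * h3
  rw [f₁, f₂]
  exact mul_ne_zero (mul_ne_zero (pow_ne_zero _ (mul_ne_zero h₀ h₁'))
    (pow_ne_zero _ (neg_ne_zero.2 h₂))) (pow_ne_zero _ (neg_ne_zero.2
      (mul_ne_zero (pow_ne_zero _ h₀) (pow_ne_zero _ h₁'))))

theorem existsUnique_isPrompt [IsAlgClosed k] [Algebra (ZMod 3) k] {a : k}
    (ha : a ^ 2 ∉ Set.range (algebraMap (ZMod 3) k)) :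
    ∃! Ω : Submodule (ZMod 3) (Form k), IsPrompt 3 4 (Qone a) (Qtwo a) Ω := by
  obtain ⟨h₀, h₁, h₂⟩ := ne_of_sq_notMem_primeField ha
  have hq := isQuarticPair_Qone_Qtwo h₀ h₁
  obtain ⟨K, hK, hw⟩ := wronskianSum_Qone_Qtwo h₀ h₁ h₂
  have hc (c : k) : c ^ 6 • wronskianSum (Qone a) (Qtwo a) = -1 ↔ c ^ 6 * K = 1 := by
    rw [hw, smul_neg, neg_inj, smul_C, ← C_1, C_inj, smul_eq_mul]
  simp only [isPrompt_iff hq, hc]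
  obtain ⟨c, hcK⟩ := IsAlgClosed.exists_pow_nat_eq K⁻¹ (n := 6) (by norm_num)
  have hcK' : c ^ 6 * K = 1 := by rw [hcK, inv_mul_cancel₀ hK]
  have hc0 : c ≠ 0 := by
    rintro rfl
    simp at hcK'
  refine ⟨_, ⟨c, hc0, hcK', rfl⟩, ?_⟩
  rintro _ ⟨c', hc'0, hc'K, rfl⟩
  -- Cubing is injective, so `c⁶` determines `c` up to sign, and a sign only negates the basis.
  have h6 : (c' ^ 2) ^ 3 = (c ^ 2) ^ 3 := by
    apply mul_right_cancel₀ hK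
    linear_combination hc'K - hcK'
  rcases sq_eq_sq_iff_eq_or_eq_neg.1 (pow_three_injective (three_eq_zero (k := k)) h6) with
    rfl | rfl
  · rfl
  · have hneg (Q₁ Q₂ : k[X]) :
        baseForm (C (-c) * Q₁) (C (-c) * Q₂) = -baseForm (C c * Q₁) (C c * Q₂) := by
      rw [← inv_pow_three_smul_baseForm, ← inv_pow_three_smul_baseForm, ← neg_smul,
        Odd.neg_pow (by decide), inv_neg]
    rw [hneg, hneg, ← Submodule.span_neg {baseForm (C c * Qone a) (C c * Qtwo a), _}]
    simp

end Family

end LogForms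

end

/-! ### The main theorem. -/

theorem mainTheorem7 {k : Type*} [Field k] [IsAlgClosed k] [Algebra (ZMod 3) k] :
    (∀ a : k, a ^ 2 ∉ Set.range (algebraMap (ZMod 3) k) →
      ∃! Ωa : Submodule (ZMod 3) (LogForms.Form k),
        LogForms.IsPrompt 3 4 (LogForms.Qone a) (LogForms.Qtwo a) Ωa) ∧
    (∀ Ω : Submodule (ZMod 3) (LogForms.Form k), LogForms.IsSpaceL 3 12 2 Ω →
      ∃ a : k, a ^ 2 ∉ Set.range (algebraMap (ZMod 3) k) ∧
        ∃ Ωa : Submodule (ZMod 3) (LogForms.Form k),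
          LogForms.IsPrompt 3 4 (LogForms.Qone a) (LogForms.Qtwo a) Ωa ∧
            LogForms.AreEquivalent 3 Ω Ωa) := by
  have : CharP k 3 := charP_of_injective_algebraMap (algebraMap (ZMod 3) k).injective 3
  refine ⟨fun a ha => LogForms.existsUnique_isPrompt ha, fun Ω hΩ => ?_⟩
  obtain ⟨Q₁, Q₂, hq, hw, rfl⟩ := LogForms.exists_isQuarticPair hΩ
  obtain ⟨R, a, e, r, s, hR, hRw, hsp, ha, he, hr, h₁, h₂⟩ := LogForms.exists_eq_Qone_Qtwo hq hw
  obtain ⟨h₀, h₁', -⟩ := LogForms.ne_of_sq_notMem_primeField ha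
  obtain ⟨c, hc⟩ := IsAlgClosed.exists_pow_nat_eq r⁻¹ (n := 3) (by norm_num)
  have hc0 : c ≠ 0 := by
    rintro rfl
    rw [zero_pow three_ne_zero] at hc
    exact inv_ne_zero hr hc.symm
  obtain ⟨σ, hσ, hσP⟩ := LogForms.exists_affine_algEquiv hr s
  -- The scalar combines `e`, from the affine change to the family, with `c`, from pulling back
  -- `dX`.
  refine ⟨a, ha, _, (LogForms.isPrompt_iff (LogForms.isQuarticPair_Qone_Qtwo h₀ h₁') _).2
    ⟨c * e, mul_ne_zero hc0 he, ?_, rfl⟩, σ, hσ, ?_⟩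
  · rw [smul_eq_C_mul, ← LogForms.wronskianSum_C_mul, C_mul, mul_assoc, mul_assoc, ← h₁, ← h₂,
      LogForms.wronskianSum_C_mul, LogForms.wronskianSum_comp, hRw, ← mul_assoc, ← C_mul]
    have : c ^ 6 * r ^ 2 = 1 := by
      rw [show c ^ 6 = (c ^ 3) ^ 2 by ring, hc, ← mul_pow, inv_mul_cancel₀ hr, one_pow]
    rw [this]
    simp
  · rw [← hsp, LogForms.image_pullback_span_pair, LogForms.pullback_baseForm hσP hc,
      LogForms.pullback_baseForm hσP hc, h₁, h₂, C_mul]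
    simp only [mul_assoc]
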